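/- Let $G=SO(3)\times SO(3)$, let $H=\{(A,A^2): A\in SO(2)\}\subset G$ (with $SO(2)\subset SO(3)$, $A\mapsto \mathrm{diag}(A,1)$), and let $V=G/H$ be the twisted Stiefel manifold. Let $s_1,s_2,s_3$ be the basis $E_{23},E_{31},E_{12}$ of $\mathfrak{so}(3)$ (where $E_{ij}$ maps $e_i\mapsto e_j$, $e_j\mapsto -e_i$ and kills the other basis vectors), $a_i=(s_i,0)$, $b_i=(0,s_i)$, so that $\mathfrak h=\mathbb R(a_3+2b_3)$, and let $\mathfrak m$ be the reductive complement with basis $\tilde e_1=b_3-2a_3$, $\tilde e_2=a_1$, $\tilde e_3=a_2$, $\tilde e_4=b_1$, $\tilde e_5=b_2$. For $\alpha,\beta,\gamma>0$ let $g=g_{\alpha\beta\gamma}$ be the $G$-invariant metric on $V$ given on $\mathfrak m$ by $\mathrm{diag}(\alpha,\beta,\beta,\gamma,\gamma)$ in this basis, with orthonormal basis $e_1=\tilde e_1/\sqrt\alpha$, $e_{2,3}=\tilde e_{2,3}/\sqrt\beta$, $e_{4,5}=\tilde e_{4,5}/\sqrt\gamma$. Invariant tensor fields on $V$ are written as $H$-invariant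 tensors on $\mathfrak m$. An almost contact metric structure is a triple $(\xi,\eta,\varphi)$ of a vector field, a $1$-form and a $(1,1)$-tensor field with $\eta(\xi)=1$, $\varphi^2=-\mathrm{Id}+\eta\otimes\xi$, $g(\varphi X,\varphi Y)=g(X,Y)-\eta(X)\eta(Y)$; its fundamental form is $F(X,Y)=g(X,\varphi Y)$; with $d\eta(X,Y)=X\eta(Y)-Y\eta(X)-\eta([X,Y])$, it is normal if $[\varphi X,\varphi Y]-\varphi[X,\varphi Y]-\varphi[\varphi X,Y]+\varphi^2[X,Y]+d\eta(X,Y)\xi=0$ for all $X,Y$, and Sasakian if it is normal and $2F=d\eta$. Let $\Upsilon$ be the symmetric $3$-tensor on $V$ given in the orthonormal basis $e_1,\dots,e_5$ by $\Upsilon(x,x,x)=x_1^3+\frac32x_1(x_2^2+x_3^2-2x_4^2-2x_5^2)+\frac{3\sqrt3}{2}(x_2^2-x_3^2)x_5-3\sqrt3\,x_2x_3x_4$; it defines the $SO(3)_{ir}$ structure of $V$, which is called nearly integrable if $(\nabla^g_X\Upsilon)(X,X,X)=0$ for all vector fields $X$, where $\nabla^g$ is the Levi-Civita connection. A characteristic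 connection of $(\xi,\eta,\varphi)$ (respectively of $\Upsilon$) is a metric connection with totally antisymmetric torsion for which $\xi,\eta,\varphi$ (respectively $\Upsilon$) are parallel; its torsion is regarded as the $3$-form $T(X,Y,Z)=g(\nabla_XY-\nabla_YX-[X,Y],Z)$. **Theorem.** Let $\alpha,\beta,\gamma>0$ and $\varphi_\pm=-E_{23}\pm E_{45}$, the $E_{ij}$ being taken in the orthonormal basis $e_1,\dots,e_5$. 1. Up to the sign of $(\xi,\eta)$ and the sign of $\varphi$, $(V,g_{\alpha\beta\gamma})$ carries exactly two $G$-invariant almost contact metric structures: the invariant almost contact metric structures are exactly the triples $(\xi,\eta,\varphi)$ with $\xi\cong\eta=\varepsilon e_1$ and $\varphi=\delta\varphi_+$ or $\varphi=\delta\varphi_-$, where $\varepsilon,\delta\in\{1,-1\}$, and $\varphi_+\ne\pm\varphi_-$. Each of them is normal and satisfies $dF=0$. Each of them admits a unique characteristic connection, and its torsion is $$T^c=\eta\wedge d\eta=\frac{2\sqrt\alpha}{5\beta}\,e_1\wedge e_2\wedge e_3-\frac{\sqrt\alpha}{5\gamma}\,e_1\wedge e_4\wedge e_5 .$$ If the $SO(3)_{ir}$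 structure of $(V,g_{\alpha\beta\gamma})$ is nearly integrable, then this connection is also the characteristic connection of the $SO(3)_{ir}$ structure, and it is the only one. 2. With $\xi\cong\eta=e_1$, the structure $(\xi,\eta,\varphi_+)$ is Sasakian if and only if $\alpha=25\beta^2=100\gamma^2$. It is Sasakian and the $SO(3)_{ir}$ structure is nearly integrable (so that the two characteristic connections coincide) if and only if $(\alpha,\beta,\gamma)=(\frac{25}{36},\frac16,\frac1{12})$. -/

import Mathlib

open scoped ContDiff Matrix

namespace TwistedStiefel

noncomputable section

/-! ### The homogeneous space `(SO(3) × SO(3)) / SO(2)_ir` -/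

abbrev SO2 := Matrix.specialOrthogonalGroup (Fin 2) ℝ

abbrev SO3 := Matrix.specialOrthogonalGroup (Fin 3) ℝ

abbrev G := SO3 × SO3

/-- The matrix `diag(A, 1)`. -/
def blockMat (A : Matrix (Fin 2) (Fin 2) ℝ) : Matrix (Fin 3) (Fin 3) ℝ :=
  !![A 0 0, A 0 1, 0; A 1 0, A 1 1, 0; 0, 0, 1]

theorem blockMat_mul (A B : Matrix (Fin 2) (Fin 2) ℝ) :
    blockMat (A * B) = blockMat A * blockMat B := by
  ext i j
  fin_cases i <;> fin_cases j <;>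
    simp [blockMat, Matrix.mul_apply, Fin.sum_univ_succ]

theorem blockMat_one : blockMat 1 = 1 := by
  ext i j
  fin_cases i <;> fin_cases j <;> simp [blockMat]

theorem blockMat_mem (A : SO2) :
    blockMat A.1 ∈ Matrix.specialOrthogonalGroup (Fin 3) ℝ := by
  obtain ⟨A, hA⟩ := A
  rw [Matrix.mem_specialOrthogonalGroup_iff] at hA ⊢
  obtain ⟨h1, h2⟩ := hA
  constructor
  · rw [Matrix.mem_orthogonalGroup_iff] at h1 ⊢
    have hs : star (blockMat A) = blockMat (star A) := by
      ext i j
      fin_cases i <;> fin_cases j <;> simp [blockMat, Matrix.star_apply]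
    have h3 : blockMat A * star (blockMat A) = 1 := by
      rw [hs, ← blockMat_mul]
      exact (congrArg blockMat h1).trans blockMat_one
    exact h3
  · rw [Matrix.det_fin_two] at h2
    simp [blockMat, Matrix.det_fin_three]
    linarith

/-- The standard embedding `SO(2) → SO(3)`, `A ↦ diag(A, 1)`. -/
def so2Embed : SO2 →* SO3 where
  toFun A := ⟨blockMat A.1, blockMat_mem A⟩
  map_one' := Subtype.ext blockMat_one
  map_mul' A B := Subtype.ext (blockMat_mul A.1 B.1)

theorem so2_comm (A B : SO2) : A * B = B * A := by
  obtain ⟨A, hA⟩ := A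
  obtain ⟨B, hB⟩ := B
  rw [Matrix.mem_specialOrthogonalGroup_fin_two_iff] at hA hB
  obtain ⟨a1, a2, -⟩ := hA
  obtain ⟨b1, b2, -⟩ := hB
  apply Subtype.ext
  ext i j
  fin_cases i <;> fin_cases j <;>
    simp [Matrix.mul_apply, Fin.sum_univ_succ, a1, a2, b1, b2] <;> ring

/-- The embedding `A ↦ (A, A²)` of `SO(2)` into `SO(3) × SO(3)`. -/
def irEmbed : SO2 →* G where
  toFun A := (so2Embed A, so2Embed (A ^ 2))
  map_one' := by simp
  map_mul' A B := by
    have h : (A * B) ^ 2 = A ^ 2 * B ^ 2 := (show Commute A B from so2_comm A B).mul_pow 2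
    simp [h]

/-- The subgroup `SO(2)_ir` of `SO(3) × SO(3)`. -/
def H : Subgroup G := irEmbed.range

/-- The twisted Stiefel manifold. -/
abbrev V := G ⧸ H

/-! ### Lie algebra, exponential map, reductive complement -/

abbrev so3 := LieAlgebra.Orthogonal.so (Fin 3) ℝ

/-- `s₁ = E₂₃`, the endomorphism of `ℝ³` with `e₂ ↦ e₃`, `e₃ ↦ -e₂`. -/
def s1 : so3 := ⟨!![0, 0, 0; 0, 0, -1; 0, 1, 0], by
  rw [LieAlgebra.Orthogonal.mem_so]
  ext i j
  fin_cases i <;> fin_cases j <;> simp⟩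

/-- `s₂ = E₃₁`. -/
def s2 : so3 := ⟨!![0, 0, 1; 0, 0, 0; -1, 0, 0], by
  rw [LieAlgebra.Orthogonal.mem_so]
  ext i j
  fin_cases i <;> fin_cases j <;> simp⟩

/-- `s₃ = E₁₂`. -/
def s3 : so3 := ⟨!![0, -1, 0; 1, 0, 0; 0, 0, 0], by
  rw [LieAlgebra.Orthogonal.mem_so]
  ext i j
  fin_cases i <;> fin_cases j <;> simp⟩

theorem exp_mem (A : so3) :
    NormedSpace.exp (A : Matrix (Fin 3) (Fin 3) ℝ) ∈
      Matrix.specialOrthogonalGroup (Fin 3) ℝ := by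
  have key : ∀ B : Matrix (Fin 3) (Fin 3) ℝ, Bᵀ = -B →
      NormedSpace.exp B * (NormedSpace.exp B)ᵀ = 1 := by
    intro B hB
    rw [← Matrix.exp_transpose, hB,
      ← Matrix.exp_add_of_commute B (-B) (Commute.neg_right (Commute.refl B)),
      add_neg_cancel, NormedSpace.exp_zero]
  have hA : (A : Matrix (Fin 3) (Fin 3) ℝ)ᵀ = -(A : Matrix (Fin 3) (Fin 3) ℝ) :=
    (LieAlgebra.Orthogonal.mem_so _ _ _).1 A.2
  rw [Matrix.mem_specialOrthogonalGroup_iff, Matrix.mem_orthogonalGroup_iff]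
  refine ⟨key _ hA, ?_⟩
  set B : Matrix (Fin 3) (Fin 3) ℝ := (2⁻¹ : ℝ) • (A : Matrix (Fin 3) (Fin 3) ℝ) with hBdef
  have hB : Bᵀ = -B := by rw [hBdef, Matrix.transpose_smul, hA, smul_neg]
  have hsum : (A : Matrix (Fin 3) (Fin 3) ℝ) = B + B := by
    rw [hBdef, ← add_smul]
    norm_num
  have hdet := congrArg Matrix.det (key B hB)
  rw [Matrix.det_mul, Matrix.det_transpose, Matrix.det_one] at hdet
  rw [hsum, Matrix.exp_add_of_commute B B (Commute.refl B), Matrix.det_mul, hdet]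

/-- The exponential map of `G = SO(3) × SO(3)`. -/
def expG (X : so3 × so3) : G := (⟨_, exp_mem X.1⟩, ⟨_, exp_mem X.2⟩)

/-- The isotropy algebra `𝔥 = ℝ ẽ₀`, `ẽ₀ = a₃ + 2 b₃`, has the complement
`𝔪 = ⟨ẽ₁, …, ẽ₅⟩` with `ẽ₁ = b₃ - 2 a₃`, `ẽ₂ = a₁`, `ẽ₃ = a₂`, `ẽ₄ = b₁`, `ẽ₅ = b₂`, where
`aᵢ = (sᵢ, 0)` and `bᵢ = (0, sᵢ)`. Elements of `𝔪` are written in coordinates with respect to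
`ẽ₁, …, ẽ₅`; the index `i : Fin 5` stands for the subscript `i + 1`. -/
abbrev Mm := Fin 5 → ℝ

/-- The inclusion of `𝔪` into `𝔤 = so(3) ⊕ so(3)`. -/
def incl (v : Mm) : so3 × so3 :=
  v 0 • (-(2 : ℝ) • s3, s3) + v 1 • (s1, 0) + v 2 • (s2, 0) + v 3 • (0, s1) + v 4 • (0, s2)

/-- The projection of `𝔤` onto `𝔪` along `𝔥`, in the above coordinates. For
`x = ∑ xᵢ aᵢ + ∑ yᵢ bᵢ` it is `((y₃ - 2 x₃) / 5, x₁, x₂, y₁, y₂)`. -/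
def proj (P Q : Matrix (Fin 3) (Fin 3) ℝ) : Mm :=
  ![(Q 1 0 - 2 * P 1 0) / 5, P 2 1, P 0 2, Q 2 1, Q 0 2]

/-- The adjoint action of `h ∈ H` on `𝔪`, i.e. the isotropy representation. -/
def isotropy (h : G) (v : Mm) : Mm :=
  proj (h.1.1 * (incl v).1.1 * (h.1⁻¹).1) (h.2.1 * (incl v).2.1 * (h.2⁻¹).1)

theorem proj_incl (v : Mm) : proj (incl v).1.1 (incl v).2.1 = v := by
  ext i
  fin_cases i <;> simp [proj, incl, s1, s2, s3]
  ring

/-- The isotropy representation is `A ↦ diag(1, A, A²)`. -/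
theorem isotropy_apply (A : SO2) (v : Mm) :
    isotropy (irEmbed A) v =
      ![v 0, A.1 0 0 * v 1 + A.1 0 1 * v 2, A.1 1 0 * v 1 + A.1 1 1 * v 2,
        (A ^ 2).1 0 0 * v 3 + (A ^ 2).1 0 1 * v 4,
        (A ^ 2).1 1 0 * v 3 + (A ^ 2).1 1 1 * v 4] := by
  have key : ∀ B : SO2, ∃ c s : ℝ, B.1 = !![c, -s; s, c] ∧ c ^ 2 + s ^ 2 = 1 := by
    intro B
    have hB := Matrix.mem_specialOrthogonalGroup_fin_two_iff.1 B.2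
    refine ⟨B.1 0 0, B.1 1 0, ?_, ?_⟩
    · ext i j
      fin_cases i <;> fin_cases j <;> simp [hB.1, hB.2.1]
    · have := hB.2.2
      rw [hB.2.1] at this
      linarith [this]
  obtain ⟨c, s, h1, hcs⟩ := key A
  obtain ⟨c', s', h2, hcs'⟩ := key (A ^ 2)
  have e1 : (irEmbed A).1.1 = blockMat A.1 := rfl
  have e2 : (irEmbed A).2.1 = blockMat (A ^ 2).1 := rfl
  have e3 : ((irEmbed A).1⁻¹).1 = (blockMat A.1)ᵀ := rfl
  have e4 : ((irEmbed A).2⁻¹).1 = (blockMat (A ^ 2).1)ᵀ := rfl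
  unfold isotropy
  rw [e1, e2, e3, e4, h1, h2]
  ext i
  fin_cases i <;>
    simp [proj, incl, s1, s2, s3, blockMat, Matrix.mul_apply, Fin.sum_univ_succ]
  · linear_combination (v 0 / 5) * hcs' + (4 * v 0 / 5) * hcs
  all_goals ring

/-! ### Smooth functions and tensor fields on `V` -/

/-- The matrix entries of an element of `G`. -/
def coords (g : G) : (Fin 3 → Fin 3 → ℝ) × (Fin 3 → Fin 3 → ℝ) :=
  (fun i j => g.1.1 i j, fun i j => g.2.1 i j)

/-- Smoothness of a map on the closed submanifold `G` of the space of pairs of matrices. -/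
def IsSmooth {E : Type} [NormedAddCommGroup E] [NormedSpace ℝ E] (f : G → E) : Prop :=
  ∃ F : (Fin 3 → Fin 3 → ℝ) × (Fin 3 → Fin 3 → ℝ) → E,
    ContDiff ℝ ∞ F ∧ ∀ g, F (coords g) = f g

theorem IsSmooth.add {E : Type} [NormedAddCommGroup E] [NormedSpace ℝ E] {f f' : G → E}
    (h : IsSmooth f) (h' : IsSmooth f') : IsSmooth (fun g => f g + f' g) := by
  obtain ⟨F, hF, hf⟩ := h
  obtain ⟨F', hF', hf'⟩ := h'
  exact ⟨fun x => F x + F' x, hF.add hF', fun g => by simp only [hf, hf']⟩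

theorem IsSmooth.smul {E : Type} [NormedAddCommGroup E] [NormedSpace ℝ E] {f : G → ℝ} {f' : G → E}
    (h : IsSmooth f) (h' : IsSmooth f') : IsSmooth (fun g => f g • f' g) := by
  obtain ⟨F, hF, hf⟩ := h
  obtain ⟨F', hF', hf'⟩ := h'
  exact ⟨fun x => F x • F' x, hF.smul hF', fun g => by simp only [hf, hf']⟩

theorem IsSmooth.const {E : Type} [NormedAddCommGroup E] [NormedSpace ℝ E] (c : E) :
    IsSmooth (fun _ => c) :=
  ⟨fun _ => c, contDiff_const, fun _ => rfl⟩

/-- Smooth functions on `V = G / H`. -/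
structure SmoothFun where
  toFun : V → ℝ
  smooth : IsSmooth (fun g : G => toFun (g : V))

/-- The pull-back of a function on `V` to `G`. -/
def SmoothFun.pull (f : SmoothFun) (g : G) : ℝ := f.toFun (g : V)

theorem SmoothFun.pull_mul (f : SmoothFun) (g : G) (h : G) (hh : h ∈ H) :
    f.pull (g * h) = f.pull g := by
  unfold SmoothFun.pull
  congr 1
  exact (QuotientGroup.eq.2 (by simpa using hh)).symm

/-- Smooth vector fields on `V`, as smooth sections of `TV = G ×_H 𝔪`, i.e. smooth
`H`-equivariant maps `G → 𝔪`. The class of `(g, v)` in `G ×_H 𝔪` is the velocity at `t = 0` of the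
curve `g exp(t v) H` in `V`. -/
@[ext]
structure VField where
  toFun : G → Mm
  smooth : IsSmooth toFun
  equivariant : ∀ g, ∀ h ∈ H, toFun (g * h) = isotropy h⁻¹ (toFun g)

/-- Smooth `1`-forms on `V`. -/
structure OneForm where
  toFun : G → Mm →ₗ[ℝ] ℝ
  smooth : ∀ v, IsSmooth (fun g => toFun g v)
  equivariant : ∀ g, ∀ h ∈ H, ∀ v, toFun (g * h) (isotropy h⁻¹ v) = toFun g v

/-- Smooth `(1,1)`-tensor fields on `V`. -/
structure EndField where
  toFun : G → Mm →ₗ[ℝ] Mm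
  smooth : ∀ v, IsSmooth (fun g => toFun g v)
  equivariant : ∀ g, ∀ h ∈ H, ∀ v,
    toFun (g * h) (isotropy h⁻¹ v) = isotropy h⁻¹ (toFun g v)

instance : CoeFun VField (fun _ => G → Mm) := ⟨VField.toFun⟩
instance : CoeFun OneForm (fun _ => G → Mm →ₗ[ℝ] ℝ) := ⟨OneForm.toFun⟩
instance : CoeFun EndField (fun _ => G → Mm →ₗ[ℝ] Mm) := ⟨EndField.toFun⟩

theorem isotropy_add {h : G} (hh : h ∈ H) (v w : Mm) :
    isotropy h (v + w) = isotropy h v + isotropy h w := by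
  obtain ⟨A, rfl⟩ := hh
  rw [isotropy_apply, isotropy_apply, isotropy_apply]
  ext i
  fin_cases i <;> simp <;> ring

theorem isotropy_smul {h : G} (hh : h ∈ H) (c : ℝ) (v : Mm) :
    isotropy h (c • v) = c • isotropy h v := by
  obtain ⟨A, rfl⟩ := hh
  rw [isotropy_apply, isotropy_apply]
  ext i
  fin_cases i <;> simp <;> ring

instance : Add VField where
  add X Y :=
    { toFun := fun g => X g + Y g
      smooth := X.smooth.add Y.smooth
      equivariant := fun g h hh => by
        rw [X.equivariant g h hh, Y.equivariant g h hh, isotropy_add (H.inv_mem hh)] }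

instance : SMul SmoothFun VField where
  smul f X :=
    { toFun := fun g => f.pull g • X g
      smooth := IsSmooth.smul (f := f.pull) f.smooth X.smooth
      equivariant := fun g h hh => by
        rw [X.equivariant g h hh, f.pull_mul g h hh, isotropy_smul (H.inv_mem hh)] }

/-- The vector field `φ X`. -/
def EndField.app (φ : EndField) (X : VField) : VField where
  toFun g := φ g (X g)
  smooth := by
    have hX : ∀ i, IsSmooth (fun g => X g i) := by
      intro i
      obtain ⟨F, hF, hf⟩ := X.smooth
      exact ⟨fun x => F x i, (contDiff_pi.1 hF) i, fun g => by simp only [hf]⟩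
    have hsum : (fun g => φ g (X g)) = fun g =>
        X g 0 • φ g (Pi.single 0 1) + X g 1 • φ g (Pi.single 1 1) + X g 2 • φ g (Pi.single 2 1)
          + X g 3 • φ g (Pi.single 3 1) + X g 4 • φ g (Pi.single 4 1) := by
      funext g
      simp only [← map_smul, ← map_add]
      congr 1
      ext i
      fin_cases i <;> simp
    rw [hsum]
    exact (((((hX 0).smul (φ.smooth _)).add ((hX 1).smul (φ.smooth _))).add
      ((hX 2).smul (φ.smooth _))).add ((hX 3).smul (φ.smooth _))).add ((hX 4).smul (φ.smooth _))
  equivariant g h hh := by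
    rw [X.equivariant g h hh, φ.equivariant g h hh]

/-- The function `η(X)`, pulled back to `G`. -/
def OneForm.app (η : OneForm) (X : VField) (g : G) : ℝ := η g (X g)

/-- The derivative `X f` of a function `f` (pulled back to `G`) along the vector field `X`:
`(X f)(g) = d/dt f(g exp(t X(g)))` at `t = 0`. -/
def VField.D (X : VField) (f : G → ℝ) (g : G) : ℝ :=
  deriv (fun t : ℝ => f (g * expG (t • incl (X g)))) 0

/-- `Z` is the commutator of `X` and `Y` as derivations of the smooth functions on `V`. -/
def IsBracket (X Y Z : VField) : Prop :=
  ∀ (f : SmoothFun) (g : G), Z.D f.pull g = X.D (Y.D f.pull) g - Y.D (X.D f.pull) g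

theorem isotropy_zero {h : G} (hh : h ∈ H) : isotropy h 0 = 0 := by
  have := isotropy_smul hh 0 0
  simpa using this

instance : Nonempty VField :=
  ⟨{ toFun := fun _ => 0
     smooth := IsSmooth.const 0
     equivariant := fun _ _ hh => (isotropy_zero (H.inv_mem hh)).symm }⟩

/-- The Lie bracket `[X, Y]` of vector fields on `V`: the vector field whose derivation is the
commutator of the derivations `X` and `Y`. -/
def bracket (X Y : VField) : VField := Classical.epsilon (IsBracket X Y)

/-! ### Invariant tensor fields -/

/-- Invariance under the action of `G` on `V` by left translations. -/
def VField.IsInvariant (X : VField) : Prop := ∀ a g : G, X (a * g) = X g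

def OneForm.IsInvariant (η : OneForm) : Prop := ∀ a g : G, η (a * g) = η g

def EndField.IsInvariant (φ : EndField) : Prop := ∀ a g : G, φ (a * g) = φ g

/-! ### The metrics `g_{αβγ}` and the standard orthonormal frame of `𝔪` -/

/-- The diagonal entries of `g_{αβγ} = diag(α, β, β, γ, γ)` in the basis `ẽ₁, …, ẽ₅`. -/
def weight (α β γ : ℝ) : Fin 5 → ℝ := ![α, β, β, γ, γ]

/-- The inner product `g_{αβγ}` on `𝔪`. -/
def metric (α β γ : ℝ) (v w : Mm) : ℝ := ∑ i, weight α β γ i * v i * w i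

/-- The orthonormal basis `e₁ = ẽ₁ / √α`, `e₂ = ẽ₂ / √β`, … . -/
def e (α β γ : ℝ) (i : Fin 5) : Mm := Pi.single i (1 / √(weight α β γ i))

/-- The dual basis of `e`. -/
def eDual (α β γ : ℝ) (i : Fin 5) : Mm →ₗ[ℝ] ℝ := √(weight α β γ i) • LinearMap.proj i

/-- The endomorphism with `eᵢ ↦ eⱼ`, `eⱼ ↦ -eᵢ`, and all other basis vectors sent to `0`. -/
def Eij (α β γ : ℝ) (i j : Fin 5) : Mm →ₗ[ℝ] Mm :=
  (eDual α β γ i).smulRight (e α β γ j) - (eDual α β γ j).smulRight (e α β γ i)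

/-- The `3`-form `eᵢ ∧ eⱼ ∧ eₖ` on `𝔪`. -/
def wedge3 (α β γ : ℝ) (i j k : Fin 5) (u v w : Mm) : ℝ :=
  Matrix.det !![eDual α β γ i u, eDual α β γ i v, eDual α β γ i w;
                eDual α β γ j u, eDual α β γ j v, eDual α β γ j w;
                eDual α β γ k u, eDual α β γ k v, eDual α β γ k w]

/-- The cubic form `Υ(X, X, X)` on `ℝ⁵`. -/
def cubic (x : Fin 5 → ℝ) : ℝ :=
  x 0 ^ 3 + 3 / 2 * x 0 * (x 1 ^ 2 + x 2 ^ 2 - 2 * x 3 ^ 2 - 2 * x 4 ^ 2)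
    + 3 * √3 / 2 * (x 1 ^ 2 - x 2 ^ 2) * x 4 - 3 * √3 * x 1 * x 2 * x 3

/-- The symmetric trilinear form with `Υ(x, x, x) = cubic x`, by polarization. -/
def upsilon0 (x y z : Fin 5 → ℝ) : ℝ :=
  (cubic (x + y + z) - cubic (x + y) - cubic (y + z) - cubic (x + z)
    + cubic x + cubic y + cubic z) / 6

/-- The tensor `Υ` on `𝔪` obtained by identifying `𝔪` with `ℝ⁵` by the orthonormal basis `e`. It
defines the `SO(3)_ir` structure of `(V, g_{αβγ})`. -/
def upsilon (α β γ : ℝ) (u v w : Mm) : ℝ :=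
  upsilon0 (fun i => eDual α β γ i u) (fun i => eDual α β γ i v) (fun i => eDual α β γ i w)

/-- `g(X, Y)` for vector fields. -/
def metricF (α β γ : ℝ) (X Y : VField) (g : G) : ℝ := metric α β γ (X g) (Y g)

/-- `Υ(X, Y, Z)` for vector fields. -/
def upsilonF (α β γ : ℝ) (X Y Z : VField) (g : G) : ℝ := upsilon α β γ (X g) (Y g) (Z g)

theorem cubic_upsilon0 (x : Fin 5 → ℝ) : upsilon0 x x x = cubic x := by
  simp only [upsilon0, cubic, Pi.add_apply]
  ring

/-- `g_{αβγ}` is invariant under the isotropy representation, so it is a metric on `V`. -/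
theorem metric_isotropy (α β γ : ℝ) {h : G} (hh : h ∈ H) (v w : Mm) :
    metric α β γ (isotropy h v) (isotropy h w) = metric α β γ v w := by
  obtain ⟨A, rfl⟩ := hh
  obtain ⟨h1, h2, h3⟩ := Matrix.mem_specialOrthogonalGroup_fin_two_iff.1 A.2
  obtain ⟨k1, k2, k3⟩ := Matrix.mem_specialOrthogonalGroup_fin_two_iff.1 (A ^ 2).2
  rw [isotropy_apply, isotropy_apply]
  rw [h1, h2] at h3
  rw [k1, k2] at k3
  simp [metric, Fin.sum_univ_succ, weight, h1, h2, k1, k2, -SubmonoidClass.coe_pow]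
  linear_combination β * (v 1 * w 1 + v 2 * w 2) * h3 + γ * (v 3 * w 3 + v 4 * w 4) * k3

/-- `Υ` is invariant under the isotropy representation, so it is a tensor field on `V`. -/
theorem upsilon_isotropy (α β γ : ℝ) {h : G} (hh : h ∈ H) (u v w : Mm) :
    upsilon α β γ (isotropy h u) (isotropy h v) (isotropy h w) = upsilon α β γ u v w := by
  have key : ∀ (A : SO2) (x : Mm), cubic (isotropy (irEmbed A) x) = cubic x := by
    intro A x
    obtain ⟨h1, h2, h3⟩ := Matrix.mem_specialOrthogonalGroup_fin_two_iff.1 A.2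
    rw [h1, h2] at h3
    have k : ∀ i j, (A ^ 2).1 i j = A.1 i 0 * A.1 0 j + A.1 i 1 * A.1 1 j := by
      intro i j
      rw [pow_two]
      simp [Matrix.mul_apply]
    rw [isotropy_apply]
    simp only [k, h1, h2, cubic, Matrix.cons_val_zero, Matrix.cons_val_one, Matrix.cons_val]
    generalize A.1 1 1 = c at *
    generalize A.1 1 0 = s at *
    have hc : c ^ 2 = 1 - s ^ 2 := by linarith
    have hc4 : c ^ 4 = 1 - 2 * s ^ 2 + s ^ 4 := by linear_combination (c ^ 2 + 1 - s ^ 2) * hc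
    ring_nf
    simp only [hc, hc4]
    ring
  have hcomm : ∀ x : Mm, (fun i => eDual α β γ i (isotropy h x)) =
      isotropy h (fun i => eDual α β γ i x) := by
    intro x
    obtain ⟨A, rfl⟩ := hh
    rw [isotropy_apply, isotropy_apply]
    ext i
    fin_cases i <;> simp [eDual, weight, -SubmonoidClass.coe_pow] <;> ring
  unfold upsilon upsilon0
  rw [hcomm, hcomm, hcomm, ← isotropy_add hh, ← isotropy_add hh, ← isotropy_add hh,
    ← isotropy_add hh]
  obtain ⟨A, rfl⟩ := hh
  simp only [key]

/-! ### The invariant tensor fields `ξ ≅ η = e₁` and `φ_± = -E₂₃ ± E₄₅` -/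

/-- The vector field `ξ = e₁`. -/
def xi (α β γ : ℝ) : VField where
  toFun _ := e α β γ 0
  smooth := IsSmooth.const _
  equivariant g h hh := by
    obtain ⟨A, hA⟩ := H.inv_mem hh
    rw [← hA, isotropy_apply]
    ext i
    fin_cases i <;> simp [e]

/-- The `1`-form `η = e₁`. -/
def eta (α β γ : ℝ) : OneForm where
  toFun _ := eDual α β γ 0
  smooth _ := IsSmooth.const _
  equivariant g h hh v := by
    obtain ⟨A, hA⟩ := H.inv_mem hh
    rw [← hA, isotropy_apply]
    simp [eDual]

/-- The `(1,1)`-tensor field `-E₂₃ + τ E₄₅`; `φ_+` and `φ_-` are the cases `τ = 1`, `τ = -1`. -/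
def phi (α β γ τ : ℝ) : EndField where
  toFun _ := -Eij α β γ 1 2 + τ • Eij α β γ 3 4
  smooth _ := IsSmooth.const _
  equivariant g h hh v := by
    obtain ⟨A, hA⟩ := H.inv_mem hh
    rw [← hA, isotropy_apply, isotropy_apply]
    obtain ⟨h1, h2, -⟩ := Matrix.mem_specialOrthogonalGroup_fin_two_iff.1 A.2
    obtain ⟨k1, k2, -⟩ := Matrix.mem_specialOrthogonalGroup_fin_two_iff.1 (A ^ 2).2
    ext i
    fin_cases i <;>
      simp [Eij, eDual, e, weight, h1, h2, k1, k2, -SubmonoidClass.coe_pow] <;> ring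

/-! ### Almost contact metric structures -/

/-- Almost contact metric structures on `(V, g_{αβγ})`: `η(ξ) = 1`, `φ² = -Id + η ⊗ ξ`,
`g(φX, φY) = g(X, Y) - η(X) η(Y)`. -/
structure IsAlmostContactMetric (α β γ : ℝ) (ξ : VField) (η : OneForm) (φ : EndField) : Prop where
  eta_xi : ∀ g, η g (ξ g) = 1
  phi_sq : ∀ g v, φ g (φ g v) = -v + η g v • ξ g
  metric_phi : ∀ g v w,
    metric α β γ (φ g v) (φ g w) = metric α β γ v w - η g v * η g w

/-- `dη(X, Y) = X(η(Y)) - Y(η(X)) - η([X, Y])`. -/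
def dOne (η : OneForm) (X Y : VField) (g : G) : ℝ :=
  X.D (η.app Y) g - Y.D (η.app X) g - η.app (bracket X Y) g

/-- The Nijenhuis tensor
`N(X, Y) = [φX, φY] - φ[X, φY] - φ[φX, Y] + φ²[X, Y] + dη(X, Y) ξ`. -/
def nijenhuis (ξ : VField) (η : OneForm) (φ : EndField) (X Y : VField) (g : G) : Mm :=
  bracket (φ.app X) (φ.app Y) g - φ g (bracket X (φ.app Y) g) - φ g (bracket (φ.app X) Y g)
    + φ g (φ g (bracket X Y g)) + dOne η X Y g • ξ g

def IsNormal (ξ : VField) (η : OneForm) (φ : EndField) : Prop :=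
  ∀ X Y g, nijenhuis ξ η φ X Y g = 0

/-- The fundamental form `F(X, Y) = g(X, φY)`. -/
def fundForm (α β γ : ℝ) (φ : EndField) (X Y : VField) (g : G) : ℝ :=
  metricF α β γ X (φ.app Y) g

/-- The exterior derivative of a `2`-form, as a function of three vector fields. -/
def dTwo (om : VField → VField → G → ℝ) (X Y Z : VField) (g : G) : ℝ :=
  X.D (om Y Z) g + Y.D (om Z X) g + Z.D (om X Y) g
    - om (bracket X Y) Z g - om (bracket Y Z) X g - om (bracket Z X) Y g

/-- The `3`-form `η ∧ dη`. -/
def etaWedgeDEta (η : OneForm) (X Y Z : VField) (g : G) : ℝ :=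
  η.app X g * dOne η Y Z g + η.app Y g * dOne η Z X g + η.app Z g * dOne η X Y g

/-- Sasakian structures: normal almost contact metric structures with `2F = dη`. -/
def IsSasakian (α β γ : ℝ) (ξ : VField) (η : OneForm) (φ : EndField) : Prop :=
  IsAlmostContactMetric α β γ ξ η φ ∧ IsNormal ξ η φ ∧
    ∀ X Y g, 2 * fundForm α β γ φ X Y g = dOne η X Y g

/-! ### Connections -/

/-- Affine connections (covariant derivatives) on `V`. -/
structure IsConnection (nabla : VField → VField → VField) : Prop where
  add_left : ∀ X X' Y, nabla (X + X') Y = nabla X Y + nabla X' Y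
  smul_left : ∀ (f : SmoothFun) X Y, nabla (f • X) Y = f • nabla X Y
  add_right : ∀ X Y Y', nabla X (Y + Y') = nabla X Y + nabla X Y'
  leibniz : ∀ (f : SmoothFun) X Y g,
    nabla X (f • Y) g = X.D f.pull g • Y g + f.pull g • nabla X Y g

/-- `∇g = 0`. -/
def IsMetricConnection (α β γ : ℝ) (nabla : VField → VField → VField) : Prop :=
  IsConnection nabla ∧ ∀ X Y Z g,
    X.D (metricF α β γ Y Z) g = metricF α β γ (nabla X Y) Z g + metricF α β γ Y (nabla X Z) g

/-- The torsion `T(X, Y) = ∇_X Y - ∇_Y X - [X, Y]`. -/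
def torsion (nabla : VField → VField → VField) (X Y : VField) (g : G) : Mm :=
  nabla X Y g - nabla Y X g - bracket X Y g

/-- The torsion as a covariant `3`-tensor `T(X, Y, Z) = g(T(X, Y), Z)`. -/
def torsion3 (α β γ : ℝ) (nabla : VField → VField → VField) (X Y Z : VField) (g : G) : ℝ :=
  metric α β γ (torsion nabla X Y g) (Z g)

/-- The torsion is totally antisymmetric (antisymmetry in `X`, `Y` is automatic). -/
def HasSkewTorsion (α β γ : ℝ) (nabla : VField → VField → VField) : Prop :=
  ∀ X Y Z g, torsion3 α β γ nabla X Y Z g = -torsion3 α β γ nabla X Z Y g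

/-- The Levi-Civita connection: metric and torsion free. -/
def IsLeviCivita (α β γ : ℝ) (nabla : VField → VField → VField) : Prop :=
  IsMetricConnection α β γ nabla ∧ ∀ X Y g, torsion nabla X Y g = 0

/-- The covariant derivative `(∇_X Υ)(Y, Z, W)`. -/
def nablaUpsilon (α β γ : ℝ) (nabla : VField → VField → VField) (X Y Z W : VField) (g : G) : ℝ :=
  X.D (upsilonF α β γ Y Z W) g - upsilonF α β γ (nabla X Y) Z W g
    - upsilonF α β γ Y (nabla X Z) W g - upsilonF α β γ Y Z (nabla X W) g

/-- The `SO(3)_ir` structure is nearly integrable: `(∇^g_X Υ)(X, X, X) = 0` for the Levi-Civita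
connection `∇^g` and all vector fields `X`. -/
def IsNearlyIntegrable (α β γ : ℝ) : Prop :=
  ∃ nabla, IsLeviCivita α β γ nabla ∧ ∀ X g, nablaUpsilon α β γ nabla X X X X g = 0

/-- Characteristic connections of the `SO(3)_ir` structure: metric connections with totally
antisymmetric torsion that preserve `Υ`. -/
def IsIrCharacteristic (α β γ : ℝ) (nabla : VField → VField → VField) : Prop :=
  IsMetricConnection α β γ nabla ∧ HasSkewTorsion α β γ nabla ∧
    ∀ X Y Z W g, nablaUpsilon α β γ nabla X Y Z W g = 0

/-- Characteristic connections of an almost contact metric structure: metric connections with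
totally antisymmetric torsion and `∇ξ = 0`, `∇η = 0`, `∇φ = 0`. -/
def IsContactCharacteristic (α β γ : ℝ) (ξ : VField) (η : OneForm) (φ : EndField)
    (nabla : VField → VField → VField) : Prop :=
  IsMetricConnection α β γ nabla ∧ HasSkewTorsion α β γ nabla ∧
    (∀ X g, nabla X ξ g = 0) ∧
    (∀ X Y g, X.D (η.app Y) g = η.app (nabla X Y) g) ∧
    (∀ X Y g, nabla X (φ.app Y) g = φ g (nabla X Y g))

/-- Invariant almost contact metric structures on `(V, g_{αβγ})`. -/
def IsInvariantACM (α β γ : ℝ) (ξ : VField) (η : OneForm) (φ : EndField) : Prop :=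
  ξ.IsInvariant ∧ η.IsInvariant ∧ φ.IsInvariant ∧ IsAlmostContactMetric α β γ ξ η φ

end

end TwistedStiefel

/-! The geometry is reduced to polynomial algebra on `𝔪`. A field on `V` is an equivariant map `G →
𝔪`, and `canon` differentiates it along `g exp(tX)`. This is the canonical connection of the
reductive splitting: tensors with constant coefficients on `𝔪` are parallel for it, and its torsion
is `-[·,·]_𝔪`. Hence `[X,Y] = canon X Y - canon Y X + brM (X, Y)` (`bracket_apply`), and in `dη`,
`dF` and the Nijenhuis tensor all derivative terms cancel, leaving identities in `brM`.

Invariant tensors are fixed by the isotropy representation `diag(1, A, A²)`, whose weights 0, 1, 2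
are distinct. So `φ` is a scalar plus a complex number on each of the two planes, and the contact
metric axioms leave only signs (`IsInvariantACM.exists_isStandard`).

The characteristic connection is `canon` plus a term by which `e₁` rotates the two planes with
speeds `p = 2α/(5β) - 2` and `q = 1 - α/(5γ)`, the values that make the torsion skew. Two metric
connections with skew torsion differ by a 3-form (`skew_difference`). If both preserve `φ`, moving
`φ` once around the three slots of this form changes its sign three times, so the form vanishes on
the image of `φ`; it also vanishes on `ξ`.

For `Υ`, the Levi-Civita connection is the characteristic one minus half its torsion, so both give
the same value of `(∇_X Υ)(X,X,X)`. That value is a multiple of `q - 2p`. For `q = 2p` the rotation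
is proportional to the generator of the isotropy algebra, which preserves `Υ`, so the contact
connection is also characteristic for `Υ`. It is the only one, because a 3-form all of whose
contractions lie in the stabilizer of `Υ` in `so(5)` is zero (`irCharacteristic_unique`).

The Sasakian condition is `√α = 5β = 10γ`; with `q = 2p` it determines the metric. -/

namespace TwistedStiefel

noncomputable section

/-! ### Derivatives along curves in `G` -/

/-- The space of pairs of `3 × 3` matrices that contains `G`. -/
abbrev Amb := (Fin 3 → Fin 3 → ℝ) × (Fin 3 → Fin 3 → ℝ)

/-- Multiplication of pairs of matrices. -/
def mulA : Amb →L[ℝ] Amb →L[ℝ] Amb :=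
  (LinearMap.mk₂ ℝ (fun M N : Amb =>
      ((fun i j => ∑ k, M.1 i k * N.1 k j, fun i j => ∑ k, M.2 i k * N.2 k j) : Amb))
    (fun M M' N => by
      ext i j <;> simp [add_mul, Finset.sum_add_distrib])
    (fun c M N => by
      ext i j <;> simp [Finset.mul_sum, mul_assoc])
    (fun M N N' => by
      ext i j <;> simp [mul_add, Finset.sum_add_distrib])
    (fun c M N => by
      ext i j <;> simp [Finset.mul_sum, mul_left_comm])).toContinuousBilinearMap

theorem mulA_apply (M N : Amb) : mulA M N =
    (fun i j => ∑ k, M.1 i k * N.1 k j, fun i j => ∑ k, M.2 i k * N.2 k j) := rfl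

theorem mulA_assoc (L M N : Amb) : mulA (mulA L M) N = mulA L (mulA M N) := by
  refine Prod.ext ?_ ?_
  · exact Matrix.mul_assoc (Matrix.of L.1) (Matrix.of M.1) (Matrix.of N.1)
  · exact Matrix.mul_assoc (Matrix.of L.2) (Matrix.of M.2) (Matrix.of N.2)

theorem coords_mul (g h : G) : coords (g * h) = mulA (coords g) (coords h) := rfl

/-- The matrix entries of an element of `𝔤`. -/
def algCoords (x : so3 × so3) : Amb := (fun i j => x.1.1 i j, fun i j => x.2.1 i j)

theorem hasDerivAt_exp_smul_entry (A : Matrix (Fin 3) (Fin 3) ℝ) (i j : Fin 3) :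
    HasDerivAt (fun t : ℝ => NormedSpace.exp (t • A) i j) (A i j) 0 := by
  -- Any algebra norm serves here, since the entries are continuous linear functionals in finite
  -- dimension.
  let _ : NormedRing (Matrix (Fin 3) (Fin 3) ℝ) := Matrix.linftyOpNormedRing
  let _ : NormedAlgebra ℝ (Matrix (Fin 3) (Fin 3) ℝ) := Matrix.linftyOpNormedAlgebra
  have h := hasDerivAt_exp_smul_const (𝕂 := ℝ) A 0
  rw [zero_smul, NormedSpace.exp_zero, one_mul] at h
  let entry : Matrix (Fin 3) (Fin 3) ℝ →ₗ[ℝ] ℝ := (LinearMap.proj j : (Fin 3 → ℝ) →ₗ[ℝ] ℝ) ∘ₗ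
    (LinearMap.proj i : (Fin 3 → Fin 3 → ℝ) →ₗ[ℝ] (Fin 3 → ℝ))
  exact (LinearMap.toContinuousLinearMap entry).hasFDerivAt.comp_hasDerivAt (0 : ℝ) h

theorem coords_expG_hasDerivAt (x : so3 × so3) :
    HasDerivAt (fun t : ℝ => coords (expG (t • x))) (algCoords x) 0 := by
  refine HasDerivAt.prodMk ?_ ?_
  · refine hasDerivAt_pi.2 fun i => hasDerivAt_pi.2 fun j => ?_
    exact hasDerivAt_exp_smul_entry x.1.1 i j
  · refine hasDerivAt_pi.2 fun i => hasDerivAt_pi.2 fun j => ?_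
    exact hasDerivAt_exp_smul_entry x.2.1 i j

theorem coords_mul_expG_hasDerivAt (g : G) (x : so3 × so3) :
    HasDerivAt (fun t : ℝ => coords (g * expG (t • x))) (mulA (coords g) (algCoords x)) 0 := by
  simp only [coords_mul]
  exact (mulA (coords g)).hasFDerivAt.comp_hasDerivAt (0 : ℝ) (coords_expG_hasDerivAt x)

theorem expG_zero_smul (x : so3 × so3) : expG ((0 : ℝ) • x) = 1 := by
  refine Prod.ext (Subtype.ext ?_) (Subtype.ext ?_)
  · change NormedSpace.exp (((0 : ℝ) • x.1 : so3) : Matrix (Fin 3) (Fin 3) ℝ) = 1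
    rw [zero_smul]; exact NormedSpace.exp_zero
  · change NormedSpace.exp (((0 : ℝ) • x.2 : so3) : Matrix (Fin 3) (Fin 3) ℝ) = 1
    rw [zero_smul]; exact NormedSpace.exp_zero

/-- The inclusion of `𝔪` into pairs of matrices. -/
def inclA : Mm →L[ℝ] Amb :=
  LinearMap.toContinuousLinearMap
    { toFun := fun v => ((![![0, 2 * v 0, v 2], ![-(2 * v 0), 0, -v 1], ![-v 2, v 1, 0]],
        ![![0, -v 0, v 4], ![v 0, 0, -v 3], ![-v 4, v 3, 0]]) : Amb)
      map_add' := fun v w => by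
        refine Prod.ext ?_ ?_ <;> ext i j <;> fin_cases i <;> fin_cases j <;> simp <;> ring
      map_smul' := fun c v => by
        refine Prod.ext ?_ ?_ <;> ext i j <;> fin_cases i <;> fin_cases j <;> simp <;> ring }

theorem inclA_apply (v : Mm) : inclA v =
    (![![0, 2 * v 0, v 2], ![-(2 * v 0), 0, -v 1], ![-v 2, v 1, 0]],
      ![![0, -v 0, v 4], ![v 0, 0, -v 3], ![-v 4, v 3, 0]]) := rfl

theorem algCoords_incl (v : Mm) : algCoords (incl v) = inclA v := by
  rw [inclA_apply]
  refine Prod.ext ?_ ?_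
  · ext i j
    fin_cases i <;> fin_cases j <;> simp [algCoords, incl, s1, s2, s3, mul_comm]
  · ext i j
    fin_cases i <;> fin_cases j <;> simp [algCoords, incl, s1, s2, s3]

section Curves

variable {E : Type} [NormedAddCommGroup E] [NormedSpace ℝ E]

/-- Chain rule for a smooth map on `G` along a differentiable curve. -/
theorem hasDerivAt_curve {f : G → E} {F : Amb → E} (hF : ContDiff ℝ ∞ F)
    (hf : ∀ g, F (coords g) = f g) {c : ℝ → G} {w : Amb}
    (hc : HasDerivAt (fun t => coords (c t)) w 0) :
    HasDerivAt (fun t => f (c t)) (fderiv ℝ F (coords (c 0)) w) 0 := by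
  simp only [← hf]
  exact ((hF.differentiable (by simp)) _).hasFDerivAt.comp_hasDerivAt (0 : ℝ) hc

/-- Smooth maps on `G` extend to the ambient matrix space, so a derivative along `g exp(tv)` is the
ordinary Fréchet derivative in the direction of the matrix product `g v`. -/
theorem hasDerivAt_expG {f : G → E} {F : Amb → E} (hF : ContDiff ℝ ∞ F)
    (hf : ∀ g, F (coords g) = f g) (g : G) (v : Mm) :
    HasDerivAt (fun t : ℝ => f (g * expG (t • incl v)))
      (fderiv ℝ F (coords g) (mulA (coords g) (inclA v))) 0 := by
  have h := hasDerivAt_curve hF hf (coords_mul_expG_hasDerivAt g (incl v))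
  rwa [expG_zero_smul, mul_one, algCoords_incl] at h

theorem IsSmooth.hasDerivAt {f : G → E} (h : IsSmooth f) (g : G) (v : Mm) :
    HasDerivAt (fun t : ℝ => f (g * expG (t • incl v)))
      (deriv (fun t : ℝ => f (g * expG (t • incl v))) 0) 0 := by
  obtain ⟨F, hF, hf⟩ := h
  exact (hasDerivAt_expG hF hf g v).differentiableAt.hasDerivAt

theorem IsSmooth.sub {f f' : G → E} (h : IsSmooth f) (h' : IsSmooth f') :
    IsSmooth (fun g => f g - f' g) := by
  obtain ⟨F, hF, hf⟩ := h
  obtain ⟨F', hF', hf'⟩ := h'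
  exact ⟨fun x => F x - F' x, hF.sub hF', fun g => by simp only [hf, hf']⟩

theorem contDiff_lieDerivative {F : Amb → E} (hF : ContDiff ℝ ∞ F) {K : Amb → Mm}
    (hK : ContDiff ℝ ∞ K) :
    ContDiff ℝ ∞ (fun M => fderiv ℝ F M (mulA M (inclA (K M)))) := by
  have h1 : ContDiff ℝ ∞ (fderiv ℝ F) := hF.fderiv_right (by simp)
  have h2 : ContDiff ℝ ∞ (fun M => mulA M (inclA (K M))) :=
    mulA.contDiff.clm_apply (inclA.contDiff.comp hK)
  exact h1.clm_apply h2

theorem IsSmooth.bilin {F : Type} [NormedAddCommGroup F] [NormedSpace ℝ F]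
    (b : Mm →ₗ[ℝ] Mm →ₗ[ℝ] F) {f f' : G → Mm}
    (h : IsSmooth f) (h' : IsSmooth f') : IsSmooth (fun g => b (f g) (f' g)) := by
  obtain ⟨K, hK, hf⟩ := h
  obtain ⟨K', hK', hf'⟩ := h'
  refine ⟨fun x => b (K x) (K' x), ?_, fun g => by simp only [hf, hf']⟩
  exact (b.toContinuousBilinearMap.contDiff.comp hK).clm_apply hK'

end Curves

/-! ### The isotropy group -/

/-- The rotation with cosine `c` and sine `s`. -/
def rot (c s : ℝ) (h : c ^ 2 + s ^ 2 = 1) : SO2 :=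
  ⟨!![c, -s; s, c], by
    rw [Matrix.mem_specialOrthogonalGroup_fin_two_iff]
    simp; exact h⟩

theorem exists_rot (A : SO2) : ∃ c s, ∃ h : c ^ 2 + s ^ 2 = 1, A = rot c s h := by
  obtain ⟨h1, h2, h3⟩ := Matrix.mem_specialOrthogonalGroup_fin_two_iff.1 A.2
  refine ⟨A.1 0 0, A.1 1 0, ?_, ?_⟩
  · rw [h2] at h3
    linarith [h3]
  · apply Subtype.ext
    ext i j
    fin_cases i <;> fin_cases j <;> simp [rot, h1, h2]

theorem rot_sq (c s : ℝ) (h : c ^ 2 + s ^ 2 = 1) :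
    ((rot c s h) ^ 2).1 = !![c ^ 2 - s ^ 2, -(2 * c * s); 2 * c * s, c ^ 2 - s ^ 2] := by
  rw [pow_two]
  ext i j
  fin_cases i <;> fin_cases j <;> simp [rot] <;> ring

theorem rot_inv (c s : ℝ) (h : c ^ 2 + s ^ 2 = 1) :
    (rot c s h)⁻¹ = rot c (-s) (by rw [neg_sq]; exact h) := by
  rw [inv_eq_iff_mul_eq_one]
  apply Subtype.ext
  ext i j
  fin_cases i <;> fin_cases j <;> simp [rot] <;> linarith

theorem coords_irEmbed_rot (c s : ℝ) (h : c ^ 2 + s ^ 2 = 1) :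
    coords (irEmbed (rot c s h)) = (![![c, -s, 0], ![s, c, 0], ![0, 0, 1]],
      ![![c ^ 2 - s ^ 2, -(2 * c * s), 0], ![2 * c * s, c ^ 2 - s ^ 2, 0], ![0, 0, 1]]) := by
  have h2 := rot_sq c s h
  refine Prod.ext ?_ ?_
  · change blockMat (rot c s h).1 = _
    ext i j
    fin_cases i <;> fin_cases j <;> simp [blockMat, rot]
  · change blockMat ((rot c s h) ^ 2).1 = _
    rw [h2]
    ext i j
    fin_cases i <;> fin_cases j <;> simp [blockMat]

theorem isotropy_rot (c s : ℝ) (h : c ^ 2 + s ^ 2 = 1) (v : Mm) :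
    isotropy (irEmbed (rot c s h)) v =
      ![v 0, c * v 1 - s * v 2, s * v 1 + c * v 2,
        (c ^ 2 - s ^ 2) * v 3 - 2 * c * s * v 4, 2 * c * s * v 3 + (c ^ 2 - s ^ 2) * v 4] := by
  rw [isotropy_apply]
  simp only [rot_sq c s h]
  ext i
  fin_cases i <;> simp [rot] <;> ring

theorem isotropy_isotropy_inv {h : G} (hh : h ∈ H) (v : Mm) :
    isotropy h (isotropy h⁻¹ v) = v := by
  obtain ⟨A, rfl⟩ := hh
  obtain ⟨c, s, h, rfl⟩ := exists_rot A
  rw [← map_inv, rot_inv, isotropy_rot, isotropy_rot]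
  -- The Pythagorean identity for the doubled angle, by which the second factor rotates.
  have h4 : (c ^ 2 + s ^ 2) ^ 2 = 1 := by rw [h]; ring
  ext i
  fin_cases i <;> simp
  · linear_combination v 1 * h
  · linear_combination v 2 * h
  · linear_combination v 3 * h4
  · linear_combination v 4 * h4

/-- `𝔪` is stable under `Ad(H)`, so the projection built into `isotropy` loses nothing and
conjugation of matrices can be used directly. This is the reductivity of the splitting. -/
theorem isotropy_conj {h : G} (hh : h ∈ H) (v : Mm) :
    mulA (coords h) (inclA v) = mulA (inclA (isotropy h v)) (coords h) := by
  obtain ⟨A, rfl⟩ := hh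
  obtain ⟨c, s, h, rfl⟩ := exists_rot A
  rw [coords_irEmbed_rot, isotropy_rot, inclA_apply, inclA_apply, mulA_apply, mulA_apply]
  have h4 : (c ^ 2 + s ^ 2) ^ 2 = 1 := by rw [h]; ring
  ext i j <;> fin_cases i <;> fin_cases j <;> simp [Fin.sum_univ_succ]
  all_goals first
    | ring1
    | linear_combination v 1 * h
    | linear_combination v 2 * h
    | linear_combination v 3 * h4
    | linear_combination v 4 * h4
    | linear_combination (-v 1) * h
    | linear_combination (-v 2) * h
    | linear_combination (-v 3) * h4

theorem isotropy_inv_conj {h : G} (hh : h ∈ H) (v : Mm) :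
    mulA (coords h) (inclA (isotropy h⁻¹ v)) = mulA (inclA v) (coords h) := by
  rw [isotropy_conj hh, isotropy_isotropy_inv hh]

/-! ### The canonical connection of the reductive space and the Lie bracket -/

theorem VField.hasDerivAt (Y : VField) (g : G) (v : Mm) :
    HasDerivAt (fun t : ℝ => Y (g * expG (t • incl v)))
      (deriv (fun t : ℝ => Y (g * expG (t • incl v))) 0) 0 :=
  Y.smooth.hasDerivAt g v

/-- The isotropy representation as a linear map. -/
def isotropyL {h : G} (hh : h ∈ H) : Mm →L[ℝ] Mm :=
  LinearMap.toContinuousLinearMap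
    { toFun := isotropy h
      map_add' := isotropy_add hh
      map_smul' := isotropy_smul hh }

/-- The canonical connection of the reductive homogeneous space `V`. -/
def canon (X Y : VField) : VField where
  toFun g := deriv (fun t : ℝ => Y (g * expG (t • incl (X g)))) 0
  smooth := by
    obtain ⟨F, hF, hf⟩ := Y.smooth
    obtain ⟨K, hK, hk⟩ := X.smooth
    refine ⟨_, contDiff_lieDerivative hF hK, fun g => ?_⟩
    beta_reduce
    rw [(hasDerivAt_expG hF hf g (X g)).deriv, hk]
  equivariant g h hh := by
    obtain ⟨F, hF, hf⟩ := Y.smooth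
    have h1 := hasDerivAt_expG hF hf (g * h) (X (g * h))
    rw [h1.deriv, X.equivariant g h hh, coords_mul, mulA_assoc, isotropy_inv_conj hh, ← mulA_assoc]
    -- Since `h · Ad(h⁻¹)X = X h`, the curve `g exp(tX) h` has the same velocity at `t = 0` as the
    -- curve through `g h` in the direction `X (g h)`; along it the equivariance of `Y` applies.
    have h2 : HasDerivAt (fun t : ℝ => coords (g * expG (t • incl (X g)) * h))
        (mulA (mulA (coords g) (inclA (X g))) (coords h)) 0 := by
      simp only [coords_mul _ h]
      have := (mulA.flip (coords h)).hasFDerivAt.comp_hasDerivAt (0 : ℝ)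
        (coords_mul_expG_hasDerivAt g (incl (X g)))
      rwa [algCoords_incl] at this
    have h3 := hasDerivAt_curve hF hf h2
    rw [expG_zero_smul, mul_one] at h3
    have h4 : HasDerivAt (fun t : ℝ => Y (g * expG (t • incl (X g)) * h))
        (isotropy h⁻¹ (deriv (fun t : ℝ => Y (g * expG (t • incl (X g)))) 0)) 0 := by
      have := (isotropyL (H.inv_mem hh)).hasFDerivAt.comp_hasDerivAt (0 : ℝ)
        (Y.hasDerivAt g (X g))
      refine this.congr_of_eventuallyEq (Filter.Eventually.of_forall fun t => ?_)
      exact Y.equivariant _ h hh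
    exact h3.unique h4

theorem canon_hasDerivAt (X Y : VField) (g : G) :
    HasDerivAt (fun t : ℝ => Y (g * expG (t • incl (X g)))) (canon X Y g) 0 :=
  Y.hasDerivAt g (X g)

/-- The `𝔪`-component of the Lie bracket of two elements of `𝔪`. -/
def brM : Mm →ₗ[ℝ] Mm →ₗ[ℝ] Mm :=
  LinearMap.mk₂ ℝ (fun v w =>
    ![(v 3 * w 4 - v 4 * w 3 - 2 * (v 1 * w 2 - v 2 * w 1)) / 5, 2 * (v 0 * w 2 - v 2 * w 0),
      -2 * (v 0 * w 1 - v 1 * w 0), -(v 0 * w 4 - v 4 * w 0), v 0 * w 3 - v 3 * w 0])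
    (fun _ _ _ => by ext i; fin_cases i <;> simp <;> ring)
    (fun _ _ _ => by ext i; fin_cases i <;> simp <;> ring)
    (fun _ _ _ => by ext i; fin_cases i <;> simp <;> ring)
    (fun _ _ _ => by ext i; fin_cases i <;> simp <;> ring)

theorem brM_apply (v w : Mm) : brM v w =
    ![(v 3 * w 4 - v 4 * w 3 - 2 * (v 1 * w 2 - v 2 * w 1)) / 5, 2 * (v 0 * w 2 - v 2 * w 0),
      -2 * (v 0 * w 1 - v 1 * w 0), -(v 0 * w 4 - v 4 * w 0), v 0 * w 3 - v 3 * w 0] := rfl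

/-- Equivariance of bilinear maps on `𝔪`. -/
def IsEquivariant (b : Mm →ₗ[ℝ] Mm →ₗ[ℝ] Mm) : Prop :=
  ∀ h ∈ H, ∀ v w, b (isotropy h v) (isotropy h w) = isotropy h (b v w)

theorem brM_isEquivariant : IsEquivariant brM := by
  rintro _ ⟨A, rfl⟩ v w
  obtain ⟨c, s, h, rfl⟩ := exists_rot A
  rw [isotropy_rot, isotropy_rot, isotropy_rot, brM_apply, brM_apply]
  have h4 : (c ^ 2 + s ^ 2) ^ 2 = 1 := by rw [h]; ring
  ext i
  fin_cases i <;> simp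
  · linear_combination (v 3 * w 4 - v 4 * w 3) * h4 - 2 * (v 1 * w 2 - v 2 * w 1) * h
  all_goals ring

/-- The generator `a₃ + 2 b₃` of the isotropy algebra. -/
def genH : Amb := (![![0, -1, 0], ![1, 0, 0], ![0, 0, 0]], ![![0, -2, 0], ![2, 0, 0], ![0, 0, 0]])

/-- The `𝔥`-component of the bracket is isolated as a multiple of `genH`, so that it can be
discarded when acting on functions on `V`. -/
theorem inclA_commutator (v w : Mm) :
    mulA (inclA v) (inclA w) - mulA (inclA w) (inclA v) = inclA (brM v w) +
      ((v 1 * w 2 - v 2 * w 1 + 2 * (v 3 * w 4 - v 4 * w 3)) / 5) • genH := by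
  rw [mulA_apply, mulA_apply, inclA_apply, inclA_apply, inclA_apply, brM_apply]
  ext i j <;> fin_cases i <;> fin_cases j <;> simp [Fin.sum_univ_succ, genH] <;> ring

theorem hasDerivAt_rot :
    HasDerivAt (fun t : ℝ => coords (irEmbed (rot (Real.cos t) (Real.sin t)
      (by rw [add_comm]; exact Real.sin_sq_add_cos_sq t)))) genH 0 := by
  simp only [coords_irEmbed_rot]
  have hc : HasDerivAt Real.cos 0 0 := by simpa using Real.hasDerivAt_cos 0
  have hs : HasDerivAt Real.sin 1 0 := by simpa using Real.hasDerivAt_sin 0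
  have h1 : HasDerivAt (fun t => Real.cos t ^ 2 - Real.sin t ^ 2) 0 0 := by
    exact ((hc.pow 2).sub (hs.pow 2)).congr_deriv (by simp)
  have h2 : HasDerivAt (fun t => 2 * Real.cos t * Real.sin t) 2 0 := by
    exact ((hc.const_mul 2).mul hs).congr_deriv (by simp)
  have h0 : ∀ c : ℝ, HasDerivAt (fun _ : ℝ => c) 0 0 := fun c => hasDerivAt_const 0 c
  have hs' : HasDerivAt (fun t => -Real.sin t) (-1) 0 := hs.neg
  have h2' : HasDerivAt (fun t => -(2 * Real.cos t * Real.sin t)) (-2) 0 := h2.neg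
  refine HasDerivAt.prodMk ?_ ?_
  · refine hasDerivAt_pi.2 fun i => hasDerivAt_pi.2 fun j => ?_
    fin_cases i <;> fin_cases j <;> simp <;> first | exact h0 _ | assumption
  · refine hasDerivAt_pi.2 fun i => hasDerivAt_pi.2 fun j => ?_
    fin_cases i <;> fin_cases j <;> simp <;> first | exact h0 _ | assumption

/-- `genH` is the velocity of a curve in `H`, along whose right translations a function pulled back
from `V` is constant. -/
theorem SmoothFun.fderiv_genH (f : SmoothFun) {F : Amb → ℝ} (hF : ContDiff ℝ ∞ F)
    (hf : ∀ g, F (coords g) = f.pull g) (g : G) :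
    fderiv ℝ F (coords g) (mulA (coords g) genH) = 0 := by
  have h1 : HasDerivAt (fun t : ℝ => coords (g * irEmbed (rot (Real.cos t) (Real.sin t)
      (by rw [add_comm]; exact Real.sin_sq_add_cos_sq t)))) (mulA (coords g) genH) 0 := by
    simp only [coords_mul]
    exact (mulA (coords g)).hasFDerivAt.comp_hasDerivAt (0 : ℝ) hasDerivAt_rot
  have h2 := hasDerivAt_curve hF hf h1
  have h3 : irEmbed (rot (Real.cos 0) (Real.sin 0)
      (by rw [add_comm]; exact Real.sin_sq_add_cos_sq 0)) = 1 := by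
    rw [← map_one irEmbed]
    congr 1
    apply Subtype.ext
    ext i j
    fin_cases i <;> fin_cases j <;> simp [rot]
  rw [h3, mul_one] at h2
  refine h2.unique ((hasDerivAt_const (0 : ℝ) (f.pull g)).congr_of_eventuallyEq
    (Filter.Eventually.of_forall fun t => ?_))
  exact f.pull_mul g _ ⟨_, rfl⟩

/-- The Lie bracket in terms of the canonical connection, whose torsion is `-[·, ·]_𝔪`. -/
def lieField (X Y : VField) : VField where
  toFun g := canon X Y g - canon Y X g + brM (X g) (Y g)
  smooth := ((canon X Y).smooth.sub (canon Y X).smooth).add (IsSmooth.bilin brM X.smooth Y.smooth)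
  equivariant g h hh := by
    rw [(canon X Y).equivariant g h hh, (canon Y X).equivariant g h hh, X.equivariant g h hh,
      Y.equivariant g h hh, brM_isEquivariant _ (H.inv_mem hh), isotropy_add (H.inv_mem hh)]
    congr 1
    exact (map_sub (isotropyL (H.inv_mem hh)) _ _).symm

/-- This is the product rule for `DF(g)(g Y(g))` along `g exp(tX)`: differentiating `DF` gives the
Hessian, differentiating the factor `g` gives the matrix product `XY`, and differentiating `Y(g)`
gives `canon X Y`. -/
theorem lieDerivative_lieDerivative (X Y : VField) {f : G → ℝ} {F : Amb → ℝ}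
    (hF : ContDiff ℝ ∞ F) (hf : ∀ g, F (coords g) = f g) (g : G) :
    X.D (Y.D f) g =
      fderiv ℝ (fderiv ℝ F) (coords g) (mulA (coords g) (inclA (X g)))
          (mulA (coords g) (inclA (Y g)))
        + fderiv ℝ F (coords g) (mulA (coords g)
            (mulA (inclA (X g)) (inclA (Y g)) + inclA (canon X Y g))) := by
  have hY : ∀ g', Y.D f g' = fderiv ℝ F (coords g') (mulA (coords g') (inclA (Y g'))) :=
    fun g' => (hasDerivAt_expG hF hf g' (Y g')).deriv
  have hF1 : ContDiff ℝ ∞ (fderiv ℝ F) := hF.fderiv_right (by simp)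
  have h1 := hasDerivAt_expG (f := fun g => fderiv ℝ F (coords g)) hF1 (fun _ => rfl) g (X g)
  have h2 := (mulA.hasFDerivAt.comp_hasDerivAt (0 : ℝ)
    (coords_mul_expG_hasDerivAt g (incl (X g)))).clm_apply
      (inclA.hasFDerivAt.comp_hasDerivAt (0 : ℝ) (canon_hasDerivAt X Y g))
  have h3 := h1.clm_apply h2
  simp only [Function.comp_apply, expG_zero_smul, mul_one, algCoords_incl] at h3
  rw [map_add (mulA _), ← mulA_assoc, ← h3.deriv, VField.D]
  simp only [hY]

/-- In the commutator the Hessians cancel by symmetry and the matrix commutator remains. Its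
`𝔥`-part acts trivially on functions on `V`, which leaves `brM`. -/
theorem isBracket_lieField (X Y : VField) : IsBracket X Y (lieField X Y) := by
  intro f g
  obtain ⟨F, hF, hf⟩ := f.smooth
  have hsym : ∀ v w, fderiv ℝ (fderiv ℝ F) (coords g) v w =
      fderiv ℝ (fderiv ℝ F) (coords g) w v := by
    have := (hF.contDiffAt (x := coords g)).isSymmSndFDerivAt
      (by rw [minSmoothness_of_isRCLikeNormedField]; exact WithTop.coe_le_coe.2 (le_top : (2 : ℕ∞) ≤ ⊤))
    exact fun v w => this v w
  rw [lieDerivative_lieDerivative X Y (f := f.pull) hF hf,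
    lieDerivative_lieDerivative Y X (f := f.pull) hF hf,
    hsym (mulA (coords g) (inclA (Y g))) (mulA (coords g) (inclA (X g))), add_sub_add_left_eq_sub,
    ← map_sub, ← map_sub, add_sub_add_comm, inclA_commutator, map_add, map_add, map_add, map_add,
    map_smul, map_smul, f.fderiv_genH hF hf, smul_zero, add_zero, ← map_sub, ← map_add, ← map_add,
    ← map_add]
  rw [show (lieField X Y).D f.pull g = _ from
    (hasDerivAt_expG (f := f.pull) hF hf g (lieField X Y g)).deriv]
  congr 3
  exact add_comm _ _

/-! ### Separation of vector fields by functions on `V` -/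

theorem coords_expG_incl_hasDerivAt (v : Mm) :
    HasDerivAt (fun t : ℝ => coords (expG (t • incl v))) (inclA v) 0 := by
  rw [← algCoords_incl]
  exact coords_expG_hasDerivAt (incl v)

/-- The function on `V` obtained by translating an `H`-invariant function by `a`. -/
def translateFun (p : Amb → ℝ) (hp : ContDiff ℝ ∞ p)
    (hinv : ∀ g : G, ∀ h ∈ H, p (coords (g * h)) = p (coords g)) (a : G) : SmoothFun where
  toFun x := Quotient.liftOn' x (fun g => p (coords (a * g))) (fun g g' hg => by
    have h := hinv (a * g) (g⁻¹ * g') (QuotientGroup.leftRel_apply.1 hg)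
    rw [← h, mul_assoc, mul_inv_cancel_left])
  smooth := ⟨fun M => p (mulA (coords a) M), hp.comp (mulA (coords a)).contDiff, fun _ => rfl⟩

theorem D_translateFun {p : Amb → ℝ} (hp : ContDiff ℝ ∞ p)
    (hinv : ∀ g : G, ∀ h ∈ H, p (coords (g * h)) = p (coords g)) (Z : VField) (g : G) :
    Z.D (translateFun p hp hinv g⁻¹).pull g =
      deriv (fun t : ℝ => p (coords (expG (t • incl (Z g))))) 0 := by
  have h : ∀ t : ℝ, (translateFun p hp hinv g⁻¹).pull (g * expG (t • incl (Z g))) =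
      p (coords (expG (t • incl (Z g)))) := fun t => by
    change p (coords (g⁻¹ * (g * expG (t • incl (Z g))))) = _
    rw [inv_mul_cancel_left]
  unfold VField.D
  simp only [h]

/-- A vector field on `V` is determined by its action on smooth functions. -/
theorem VField.ext_D {Z Z' : VField}
    (h : ∀ (f : SmoothFun) (g : G), Z.D f.pull g = Z'.D f.pull g) : Z = Z' := by
  have key : ∀ (p : Amb → ℝ), ContDiff ℝ ∞ p →
      (∀ g : G, ∀ h ∈ H, p (coords (g * h)) = p (coords g)) → ∀ g,
      deriv (fun t : ℝ => p (coords (expG (t • incl (Z g))))) 0 =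
        deriv (fun t : ℝ => p (coords (expG (t • incl (Z' g))))) 0 := by
    intro p hp hinv g
    rw [← D_translateFun hp hinv, ← D_translateFun hp hinv, h]
  have e1 : ∀ (v : Mm) i j, HasDerivAt (fun t : ℝ => (coords (expG (t • incl v))).1 i j)
      ((inclA v).1 i j) 0 := fun v i j =>
    hasDerivAt_pi.1 (hasDerivAt_pi.1 (coords_expG_incl_hasDerivAt v).fst i) j
  have e2 : ∀ (v : Mm) i j, HasDerivAt (fun t : ℝ => (coords (expG (t • incl v))).2 i j)
      ((inclA v).2 i j) 0 := fun v i j =>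
    hasDerivAt_pi.1 (hasDerivAt_pi.1 (coords_expG_incl_hasDerivAt v).snd i) j
  -- `H` fixes the third basis vector in both factors, so third columns are functions on `V`. Their
  -- derivatives at the identity detect the last four coordinates of `𝔪`.
  have k1 : ∀ i g, (inclA (Z g)).1 i 2 = (inclA (Z' g)).1 i 2 := by
    intro i g
    have := key (fun M => M.1 i 2) (by fun_prop) (by
      rintro g _ ⟨A, rfl⟩
      obtain ⟨c, s, h, rfl⟩ := exists_rot A
      rw [coords_mul, coords_irEmbed_rot, mulA_apply]
      simp [Fin.sum_univ_succ]) g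
    rwa [(e1 _ i 2).deriv, (e1 _ i 2).deriv] at this
  have k2 : ∀ i g, (inclA (Z g)).2 i 2 = (inclA (Z' g)).2 i 2 := by
    intro i g
    have := key (fun M => M.2 i 2) (by fun_prop) (by
      rintro g _ ⟨A, rfl⟩
      obtain ⟨c, s, h, rfl⟩ := exists_rot A
      rw [coords_mul, coords_irEmbed_rot, mulA_apply]
      simp [Fin.sum_univ_succ]) g
    rwa [(e2 _ i 2).deriv, (e2 _ i 2).deriv] at this
  have k3 : ∀ g, Z g 0 = Z' g 0 := by
    intro g
    -- Let `z` and `w` be the complex numbers formed by the first two entries of the first row in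
    -- each factor. A rotation in `H` multiplies them by `e^{-iθ}` and `e^{-2iθ}`, so the imaginary
    -- part of `conj(z)² w` is a function on `V`. It detects the remaining coordinate, with
    -- derivative `-5 v 0`.
    have := key (fun M => (M.1 0 0 * M.1 0 0 - M.1 0 1 * M.1 0 1) * M.2 0 1
        - 2 * M.1 0 0 * M.1 0 1 * M.2 0 0) (by fun_prop) (by
      rintro g _ ⟨A, rfl⟩
      obtain ⟨c, s, h, rfl⟩ := exists_rot A
      rw [coords_mul, coords_irEmbed_rot, mulA_apply]
      simp [Fin.sum_univ_succ]
      generalize coords g = M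
      have h2 : (c ^ 2 + s ^ 2) ^ 2 = 1 := by rw [h]; ring
      linear_combination ((M.1 0 0 * M.1 0 0 - M.1 0 1 * M.1 0 1) * M.2 0 1
        - 2 * M.1 0 0 * M.1 0 1 * M.2 0 0) * h2) g
    have h5 : ∀ v : Mm, deriv (fun t : ℝ => (fun M : Amb =>
        (M.1 0 0 * M.1 0 0 - M.1 0 1 * M.1 0 1) * M.2 0 1
          - 2 * M.1 0 0 * M.1 0 1 * M.2 0 0) (coords (expG (t • incl v)))) 0 = -5 * v 0 := by
      intro v
      have h6 := (((((e1 v 0 0).mul (e1 v 0 0)).sub ((e1 v 0 1).mul (e1 v 0 1))).mul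
        (e2 v 0 1)).sub ((((e1 v 0 0).const_mul 2).mul (e1 v 0 1)).mul (e2 v 0 0))).deriv
      refine h6.trans ?_
      have h7 : coords 1 = (fun i j => (1 : Matrix (Fin 3) (Fin 3) ℝ) i j,
        fun i j => (1 : Matrix (Fin 3) (Fin 3) ℝ) i j) := rfl
      simp only [expG_zero_smul, h7, inclA_apply, Pi.mul_apply, Pi.sub_apply]
      simp
      ring
    rw [h5, h5] at this
    linarith
  ext g i
  have a1 := k1 0 g
  have a2 := k1 1 g
  have a3 := k2 0 g
  have a4 := k2 1 g
  simp only [inclA_apply] at a1 a2 a3 a4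
  fin_cases i
  · exact k3 g
  · simpa using a2
  · simpa using a1
  · simpa using a4
  · simpa using a3

/-- `bracket` is defined by choice: `isBracket_lieField` shows that the choice meets its
specification, and `VField.ext_D` that only one field can. -/
theorem bracket_eq (X Y : VField) : bracket X Y = lieField X Y := by
  have h1 : IsBracket X Y (bracket X Y) := Classical.epsilon_spec ⟨_, isBracket_lieField X Y⟩
  exact VField.ext_D fun f g => (h1 f g).trans (isBracket_lieField X Y f g).symm

theorem bracket_apply (X Y : VField) (g : G) :
    bracket X Y g = canon X Y g - canon Y X g + brM (X g) (Y g) := by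
  rw [bracket_eq]
  rfl

/-! ### Vector fields with prescribed values -/

/-- The projection to `𝔪` of the skew-symmetric part of a pair of matrices. -/
def projA : Amb →ₗ[ℝ] Mm where
  toFun M := ![((M.2 1 0 - M.2 0 1) / 2 - 2 * ((M.1 1 0 - M.1 0 1) / 2)) / 5,
    (M.1 2 1 - M.1 1 2) / 2, (M.1 0 2 - M.1 2 0) / 2,
    (M.2 2 1 - M.2 1 2) / 2, (M.2 0 2 - M.2 2 0) / 2]
  map_add' M N := by ext i; fin_cases i <;> simp <;> ring
  map_smul' c M := by ext i; fin_cases i <;> simp <;> ring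

theorem projA_apply (M : Amb) : projA M =
    ![((M.2 1 0 - M.2 0 1) / 2 - 2 * ((M.1 1 0 - M.1 0 1) / 2)) / 5,
    (M.1 2 1 - M.1 1 2) / 2, (M.1 0 2 - M.1 2 0) / 2,
    (M.2 2 1 - M.2 1 2) / 2, (M.2 0 2 - M.2 2 0) / 2] := rfl

theorem projA_inclA (v : Mm) : projA (inclA v) = v := by
  rw [projA_apply, inclA_apply]
  ext i
  fin_cases i <;> simp
  ring

theorem projA_conj {h : G} (hh : h ∈ H) (M : Amb) :
    projA (mulA (mulA (coords h⁻¹) M) (coords h)) = isotropy h⁻¹ (projA M) := by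
  obtain ⟨A, rfl⟩ := hh
  obtain ⟨c, s, h, rfl⟩ := exists_rot A
  have h4 : (c ^ 2 + s ^ 2) ^ 2 = 1 := by rw [h]; ring
  rw [← map_inv, rot_inv, coords_irEmbed_rot, coords_irEmbed_rot, isotropy_rot, projA_apply,
    projA_apply, mulA_apply, mulA_apply]
  ext i
  fin_cases i <;> simp [Fin.sum_univ_succ]
  · linear_combination (M.2 1 0 - M.2 0 1) / 2 * h4 - (M.1 1 0 - M.1 0 1) * h
  all_goals ring

theorem coords_one_mul (M : Amb) : mulA (coords 1) M = M :=
  Prod.ext (Matrix.one_mul (Matrix.of M.1)) (Matrix.one_mul (Matrix.of M.2))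

theorem coords_mul_one (M : Amb) : mulA M (coords 1) = M :=
  Prod.ext (Matrix.mul_one (Matrix.of M.1)) (Matrix.mul_one (Matrix.of M.2))

/-- The fundamental vector field of the action of `G` on `V` given by an element of `𝔤`. -/
def killing (W : Amb) : VField where
  toFun g := projA (mulA (mulA (coords g⁻¹) W) (coords g))
  smooth := by
    -- On `G` the inverse is the transpose, which is smooth on all of the ambient space.
    refine ⟨fun M => projA (mulA (mulA ((fun i j => M.1 j i, fun i j => M.2 j i) : Amb) W) M),
      ?_, fun g => rfl⟩
    have h1 : ContDiff ℝ ∞ (fun M : Amb => ((fun i j => M.1 j i, fun i j => M.2 j i) : Amb)) := by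
      fun_prop
    exact (LinearMap.toContinuousLinearMap projA).contDiff.comp
      ((mulA.contDiff.comp ((mulA.contDiff.comp h1).clm_apply contDiff_const)).clm_apply contDiff_id)
  equivariant g h hh := by
    rw [← projA_conj hh, mul_inv_rev, coords_mul, coords_mul, mulA_assoc, mulA_assoc, mulA_assoc,
      mulA_assoc, mulA_assoc]

/-- `G` acts transitively, so fundamental fields take every value at every point. This turns
identities between fields into identities on `𝔪`. -/
theorem exists_vField (g : G) (v : Mm) : ∃ X : VField, X g = v := by
  refine ⟨killing (mulA (mulA (coords g) (inclA v)) (coords g⁻¹)), ?_⟩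
  change projA (mulA (mulA (coords g⁻¹) (mulA (mulA (coords g) (inclA v)) (coords g⁻¹)))
    (coords g)) = v
  rw [mulA_assoc, mulA_assoc, ← coords_mul, ← mulA_assoc, ← mulA_assoc, ← coords_mul,
    inv_mul_cancel, coords_mul_one, coords_one_mul, projA_inclA]

/-! ### Derivatives of invariant tensors -/

theorem metric_eq (α β γ : ℝ) (v w : Mm) : metric α β γ v w =
    α * (v 0 * w 0) + β * (v 1 * w 1 + v 2 * w 2) + γ * (v 3 * w 3 + v 4 * w 4) := by
  simp [metric, Fin.sum_univ_succ, weight]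
  ring

theorem metric_comm (α β γ : ℝ) (v w : Mm) : metric α β γ v w = metric α β γ w v := by
  rw [metric_eq, metric_eq]
  ring

theorem metric_add_left (α β γ : ℝ) (u v w : Mm) :
    metric α β γ (u + v) w = metric α β γ u w + metric α β γ v w := by
  simp only [metric_eq, Pi.add_apply]
  ring

theorem metric_sub_left (α β γ : ℝ) (u v w : Mm) :
    metric α β γ (u - v) w = metric α β γ u w - metric α β γ v w := by
  simp only [metric_eq, Pi.sub_apply]
  ring

theorem metric_add_right (α β γ : ℝ) (u v w : Mm) :
    metric α β γ u (v + w) = metric α β γ u v + metric α β γ u w := by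
  simp only [metric_eq, Pi.add_apply]
  ring

theorem metric_sub_right (α β γ : ℝ) (u v w : Mm) :
    metric α β γ u (v - w) = metric α β γ u v - metric α β γ u w := by
  simp only [metric_eq, Pi.sub_apply]
  ring

theorem eq_zero_of_metric_self {α β γ : ℝ} (hα : 0 < α) (hβ : 0 < β) (hγ : 0 < γ) {v : Mm}
    (h : metric α β γ v v = 0) : v = 0 := by
  rw [metric_eq] at h
  have h0 := mul_nonneg hα.le (mul_self_nonneg (v 0))
  have h1 := mul_nonneg hβ.le (mul_self_nonneg (v 1))
  have h2 := mul_nonneg hβ.le (mul_self_nonneg (v 2))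
  have h3 := mul_nonneg hγ.le (mul_self_nonneg (v 3))
  have h4 := mul_nonneg hγ.le (mul_self_nonneg (v 4))
  have key : ∀ {a x : ℝ}, 0 < a → a * (x * x) = 0 → x = 0 := fun ha hx => by
    simpa [ha.ne'] using hx
  ext i
  fin_cases i
  · exact (key hα (by linarith) : v 0 = 0)
  · exact (key hβ (by linarith) : v 1 = 0)
  · exact (key hβ (by linarith) : v 2 = 0)
  · exact (key hγ (by linarith) : v 3 = 0)
  · exact (key hγ (by linarith) : v 4 = 0)

theorem canon_apply_hasDerivAt (X Y : VField) (g : G) (i : Fin 5) :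
    HasDerivAt (fun t : ℝ => Y (g * expG (t • incl (X g))) i) (canon X Y g i) 0 :=
  hasDerivAt_pi.1 (canon_hasDerivAt X Y g) i

theorem D_linear (X Y : VField) (L : Mm →ₗ[ℝ] ℝ) (g : G) :
    X.D (fun g => L (Y g)) g = L (canon X Y g) :=
  ((LinearMap.toContinuousLinearMap L).hasFDerivAt.comp_hasDerivAt (0 : ℝ)
    (canon_hasDerivAt X Y g)).deriv

/-- The coefficients of the metric on `𝔪` are constant, so the product rule says that it is parallel
for `canon`. -/
theorem D_metricF (α β γ : ℝ) (X Y Z : VField) (g : G) :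
    X.D (metricF α β γ Y Z) g =
      metric α β γ (canon X Y g) (Z g) + metric α β γ (Y g) (canon X Z g) := by
  have hY := canon_apply_hasDerivAt X Y g
  have hZ := canon_apply_hasDerivAt X Z g
  have h := (((hY 0).mul (hZ 0)).const_mul α).add
    (((((hY 1).mul (hZ 1)).add ((hY 2).mul (hZ 2))).const_mul β).add
      ((((hY 3).mul (hZ 3)).add ((hY 4).mul (hZ 4))).const_mul γ))
  have h2 : (fun t : ℝ => metricF α β γ Y Z (g * expG (t • incl (X g)))) = _ :=
    funext fun t => (metric_eq α β γ _ _).trans (add_assoc _ _ _)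
  unfold VField.D
  rw [h2]
  refine h.deriv.trans ?_
  simp only [expG_zero_smul, mul_one, metric_eq]
  ring

/-- The derivative of `cubic`. -/
def cubicDeriv (x x' : Fin 5 → ℝ) : ℝ :=
  3 * x 0 ^ 2 * x' 0 + 3 / 2 * x' 0 * (x 1 ^ 2 + x 2 ^ 2 - 2 * x 3 ^ 2 - 2 * x 4 ^ 2)
    + 3 * x 0 * (x 1 * x' 1 + x 2 * x' 2 - 2 * x 3 * x' 3 - 2 * x 4 * x' 4)
    + 3 * √3 / 2 * (2 * (x 1 * x' 1 - x 2 * x' 2) * x 4 + (x 1 ^ 2 - x 2 ^ 2) * x' 4)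
    - 3 * √3 * (x' 1 * x 2 * x 3 + x 1 * x' 2 * x 3 + x 1 * x 2 * x' 3)

theorem hasDerivAt_cubic {x : ℝ → Fin 5 → ℝ} {x' : Fin 5 → ℝ} {t : ℝ} (hx : HasDerivAt x x' t) :
    HasDerivAt (fun t => cubic (x t)) (cubicDeriv (x t) x') t := by
  have h := hasDerivAt_pi.1 hx
  have h0 := h 0
  have h1 := h 1
  have h2 := h 2
  have h3 := h 3
  have h4 := h 4
  refine ((((h0.pow 3).add ((h0.const_mul (3 / 2)).mul
    ((((h1.pow 2).add (h2.pow 2)).sub ((h3.pow 2).const_mul 2)).sub ((h4.pow 2).const_mul 2)))).add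
    ((((h1.pow 2).sub (h2.pow 2)).const_mul (3 * √3 / 2)).mul h4)).sub
    (((h1.const_mul (3 * √3)).mul h2).mul h3)).congr_deriv ?_
  simp only [cubicDeriv, Pi.add_apply, Pi.sub_apply, Pi.pow_apply, Pi.mul_apply]
  norm_num
  ring

theorem hasDerivAt_upsilon0 {x y z : ℝ → Fin 5 → ℝ} {x' y' z' : Fin 5 → ℝ} {t : ℝ}
    (hx : HasDerivAt x x' t) (hy : HasDerivAt y y' t) (hz : HasDerivAt z z' t) :
    HasDerivAt (fun t => upsilon0 (x t) (y t) (z t))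
      (upsilon0 x' (y t) (z t) + upsilon0 (x t) y' (z t) + upsilon0 (x t) (y t) z') t := by
  refine ((((((((hasDerivAt_cubic ((hx.add hy).add hz)).sub (hasDerivAt_cubic (hx.add hy))).sub
    (hasDerivAt_cubic (hy.add hz))).sub (hasDerivAt_cubic (hx.add hz))).add
    (hasDerivAt_cubic hx)).add (hasDerivAt_cubic hy)).add
    (hasDerivAt_cubic hz)).div_const 6).congr_deriv ?_
  simp only [cubicDeriv, upsilon0, cubic, Pi.add_apply]
  ring

theorem D_upsilonF (α β γ : ℝ) (X Y Z W : VField) (g : G) :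
    X.D (upsilonF α β γ Y Z W) g = upsilon α β γ (canon X Y g) (Z g) (W g)
      + upsilon α β γ (Y g) (canon X Z g) (W g) + upsilon α β γ (Y g) (Z g) (canon X W g) := by
  have key : ∀ Y : VField, HasDerivAt
      (fun t : ℝ => fun i => eDual α β γ i (Y (g * expG (t • incl (X g)))))
      (fun i => eDual α β γ i (canon X Y g)) 0 := fun Y => hasDerivAt_pi.2 fun i =>
    (LinearMap.toContinuousLinearMap (eDual α β γ i)).hasFDerivAt.comp_hasDerivAt (0 : ℝ)
      (canon_hasDerivAt X Y g)
  have h := (hasDerivAt_upsilon0 (key Y) (key Z) (key W)).deriv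
  simp only [expG_zero_smul, mul_one] at h
  exact h

theorem upsilon_eq (α β γ : ℝ) (u v w : Mm) : upsilon α β γ u v w =
    √α ^ 3 * (u 0 * v 0 * w 0)
    + √α * √β ^ 2 / 2 * (u 0 * (v 1 * w 1 + v 2 * w 2) + v 0 * (u 1 * w 1 + u 2 * w 2)
        + w 0 * (u 1 * v 1 + u 2 * v 2))
    - √α * √γ ^ 2 * (u 0 * (v 3 * w 3 + v 4 * w 4) + v 0 * (u 3 * w 3 + u 4 * w 4)
        + w 0 * (u 3 * v 3 + u 4 * v 4))
    + √3 * √β ^ 2 * √γ / 2 * ((u 1 * v 1 - u 2 * v 2) * w 4 + (u 1 * w 1 - u 2 * w 2) * v 4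
        + (v 1 * w 1 - v 2 * w 2) * u 4
        - (u 1 * v 2 + u 2 * v 1) * w 3 - (u 1 * w 2 + u 2 * w 1) * v 3
        - (v 1 * w 2 + v 2 * w 1) * u 3) := by
  simp only [upsilon, upsilon0, cubic, eDual, weight, Pi.add_apply, LinearMap.smul_apply,
    LinearMap.proj_apply, smul_eq_mul, Matrix.cons_val]
  ring

/-! ### Invariant connections -/

/-- Linearity in the direction of differentiation, from which tensoriality of `canon X Y` in `X`
follows. -/
theorem VField.exists_clm (Y : VField) (g : G) : ∃ L : Mm →L[ℝ] Mm, ∀ v,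
    deriv (fun t : ℝ => Y (g * expG (t • incl v))) 0 = L v := by
  obtain ⟨F, hF, hf⟩ := Y.smooth
  exact ⟨(fderiv ℝ F (coords g)).comp ((mulA (coords g)).comp inclA),
    fun v => (hasDerivAt_expG hF hf g v).deriv⟩

/-- The invariant connection that differs from the canonical one by a bilinear map on `𝔪`. -/
def conn (b : Mm →ₗ[ℝ] Mm →ₗ[ℝ] Mm) (hb : IsEquivariant b) (X Y : VField) : VField where
  toFun g := canon X Y g + b (X g) (Y g)
  smooth := (canon X Y).smooth.add (IsSmooth.bilin b X.smooth Y.smooth)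
  equivariant g h hh := by
    rw [(canon X Y).equivariant g h hh, X.equivariant g h hh, Y.equivariant g h hh,
      hb _ (H.inv_mem hh), isotropy_add (H.inv_mem hh)]

theorem conn_apply {b : Mm →ₗ[ℝ] Mm →ₗ[ℝ] Mm} (hb : IsEquivariant b) (X Y : VField) (g : G) :
    conn b hb X Y g = canon X Y g + b (X g) (Y g) := rfl

theorem VField.add_apply (X Y : VField) (g : G) : (X + Y) g = X g + Y g := rfl

theorem VField.smul_apply (f : SmoothFun) (X : VField) (g : G) : (f • X) g = f.pull g • X g := rfl

theorem canon_isConnection : IsConnection canon where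
  add_left X X' Y := by
    refine VField.ext (funext fun g => ?_)
    obtain ⟨L, hL⟩ := Y.exists_clm g
    rw [VField.add_apply]
    change deriv _ _ = deriv _ _ + deriv _ _
    rw [hL, hL, hL, VField.add_apply, map_add]
  smul_left f X Y := by
    refine VField.ext (funext fun g => ?_)
    obtain ⟨L, hL⟩ := Y.exists_clm g
    rw [VField.smul_apply]
    change deriv _ _ = _ • deriv _ _
    rw [hL, hL, VField.smul_apply, map_smul]
  add_right X Y Y' := by
    refine VField.ext (funext fun g => ?_)
    exact ((canon_hasDerivAt X Y g).add (canon_hasDerivAt X Y' g)).deriv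
  leibniz f X Y g := by
    have hf : HasDerivAt (fun t : ℝ => f.pull (g * expG (t • incl (X g)))) (X.D f.pull g) 0 :=
      IsSmooth.hasDerivAt (f := f.pull) f.smooth g (X g)
    have h := (hf.smul (canon_hasDerivAt X Y g)).deriv
    simp only [expG_zero_smul, mul_one] at h
    exact h.trans (add_comm _ _)

theorem conn_isConnection {b : Mm →ₗ[ℝ] Mm →ₗ[ℝ] Mm} (hb : IsEquivariant b) :
    IsConnection (conn b hb) where
  add_left X X' Y := by
    refine VField.ext (funext fun g => ?_)
    simp only [conn_apply, VField.add_apply, canon_isConnection.add_left, map_add,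
      LinearMap.add_apply]
    abel
  smul_left f X Y := by
    refine VField.ext (funext fun g => ?_)
    simp only [conn_apply, VField.smul_apply, canon_isConnection.smul_left, map_smul,
      LinearMap.smul_apply, smul_add]
  add_right X Y Y' := by
    refine VField.ext (funext fun g => ?_)
    simp only [conn_apply, VField.add_apply, canon_isConnection.add_right, map_add]
    abel
  leibniz f X Y g := by
    simp only [conn_apply, VField.smul_apply, canon_isConnection.leibniz, map_smul, smul_add]
    abel

theorem conn_isMetricConnection {α β γ : ℝ} {b : Mm →ₗ[ℝ] Mm →ₗ[ℝ] Mm} (hb : IsEquivariant b)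
    (h : ∀ x y z, metric α β γ (b x y) z + metric α β γ y (b x z) = 0) :
    IsMetricConnection α β γ (conn b hb) := by
  refine ⟨conn_isConnection hb, fun X Y Z g => ?_⟩
  rw [D_metricF, metricF, metricF, conn_apply, conn_apply, metric_add_left, metric_add_right]
  linarith [h (X g) (Y g) (Z g)]

theorem conn_torsion {b : Mm →ₗ[ℝ] Mm →ₗ[ℝ] Mm} (hb : IsEquivariant b) (X Y : VField) (g : G) :
    torsion (conn b hb) X Y g = b (X g) (Y g) - b (Y g) (X g) - brM (X g) (Y g) := by
  rw [torsion, conn_apply, conn_apply, bracket_apply]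
  abel

/-! ### Rigidity of metric connections -/

theorem metric_difference {α β γ : ℝ} {nabla nabla' : VField → VField → VField}
    (h : IsMetricConnection α β γ nabla) (h' : IsMetricConnection α β γ nabla')
    (X Y Z : VField) (g : G) :
    metric α β γ (nabla X Y g - nabla' X Y g) (Z g) =
      -metric α β γ (nabla X Z g - nabla' X Z g) (Y g) := by
  have h1 := h.2 X Y Z g
  rw [h'.2 X Y Z g] at h1
  simp only [metricF] at h1
  rw [metric_sub_left, metric_sub_left, metric_comm _ _ _ _ (Y g), metric_comm _ _ _ _ (Y g)]
  linarith

/-- The difference of two metric connections with skew torsion is totally skew. -/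
theorem skew_difference {α β γ : ℝ} {nabla nabla' : VField → VField → VField}
    (h : IsMetricConnection α β γ nabla) (h' : IsMetricConnection α β γ nabla')
    (hs : HasSkewTorsion α β γ nabla) (hs' : HasSkewTorsion α β γ nabla')
    (X Y Z : VField) (g : G) :
    metric α β γ (nabla X Y g - nabla' X Y g) (Z g) =
      -metric α β γ (nabla Y X g - nabla' Y X g) (Z g) := by
  have hm := fun X Y Z => metric_difference h h' X Y Z g
  -- For the difference tensor, skew torsion and metricity together give invariance under cyclic
  -- permutation of the slots; with skewness in the last two slots this is total skewness.
  have hc : ∀ X Y Z : VField, metric α β γ (nabla Y X g - nabla' Y X g) (Z g) =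
      metric α β γ (nabla Z Y g - nabla' Z Y g) (X g) := by
    intro X Y Z
    have t := hs X Y Z g
    have t' := hs' X Y Z g
    have m1 := hm X Y Z
    have m2 := hm Z X Y
    simp only [torsion3, torsion, metric_sub_left] at t t' m1 m2 ⊢
    linarith
  linarith [hc X Y Z, hc Y Z X, hm X Y Z]

/-- Vanishing torsion is skew, so the difference tensor is alternating in its first two arguments;
torsion-freeness also makes it symmetric in them. -/
theorem leviCivita_unique {α β γ : ℝ} (hα : 0 < α) (hβ : 0 < β) (hγ : 0 < γ)
    {nabla nabla' : VField → VField → VField}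
    (h : IsLeviCivita α β γ nabla) (h' : IsLeviCivita α β γ nabla') : nabla = nabla' := by
  have key : ∀ (X Y Z : VField) (g : G), metric α β γ (nabla X Y g - nabla' X Y g) (Z g) = 0 := by
    intro X Y Z g
    have hskew : ∀ {n : VField → VField → VField}, IsLeviCivita α β γ n →
        HasSkewTorsion α β γ n := fun hn X Y Z g => by
      simp [torsion3, hn.2, metric_eq]
    have h1 := skew_difference h.1 h'.1 (hskew h) (hskew h') X Y Z g
    have t := h.2 X Y g
    have t' := h'.2 X Y g
    have h2 : nabla X Y g - nabla' X Y g = nabla Y X g - nabla' Y X g := by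
      rw [torsion] at t t'
      rw [← sub_eq_zero, ← sub_self (0 : Mm)]
      nth_rewrite 1 [← t]
      rw [← t']
      abel
    rw [h2] at h1 ⊢
    linarith
  funext X Y
  refine VField.ext (funext fun g => ?_)
  rw [← sub_eq_zero]
  refine eq_zero_of_metric_self hα hβ hγ ?_
  rw [metric_sub_right, key, key, sub_zero]

/-! ### Invariant almost contact metric structures -/

/-- The triple `(ξ, η, φ)` is `(±e₁, ±e₁, -a E₂₃ + b E₄₅)` with `a, b ∈ {1, -1}`. -/
structure IsStandard (α ε a b : ℝ) (ξ : VField) (η : OneForm) (φ : EndField) : Prop where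
  sign_eps : ε = 1 ∨ ε = -1
  sign_a : a = 1 ∨ a = -1
  sign_b : b = 1 ∨ b = -1
  xi_apply : ∀ g, ξ g = ![ε / √α, 0, 0, 0, 0]
  eta_apply : ∀ g v, η g v = ε * √α * v 0
  phi_apply : ∀ g v, φ g v = ![0, a * v 2, -(a * v 1), -(b * v 4), b * v 3]

theorem xi_apply (α β γ : ℝ) (g : G) : xi α β γ g = ![1 / √α, 0, 0, 0, 0] := by
  ext i
  fin_cases i <;> simp [xi, e, weight]

theorem eta_apply (α β γ : ℝ) (g : G) (v : Mm) : eta α β γ g v = √α * v 0 := by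
  simp [eta, eDual, weight]

theorem phi_apply (α : ℝ) {β γ : ℝ} (hβ : 0 < β) (hγ : 0 < γ) (τ : ℝ) (g : G) (v : Mm) :
    phi α β γ τ g v = ![0, v 2, -v 1, -(τ * v 4), τ * v 3] := by
  have h1 : √β ≠ 0 := (Real.sqrt_pos.2 hβ).ne'
  have h2 : √γ ≠ 0 := (Real.sqrt_pos.2 hγ).ne'
  ext i
  fin_cases i <;> simp [phi, Eij, eDual, e, weight] <;> field_simp <;> simp

theorem isStandard_of_eq {α β γ : ℝ} (hβ : 0 < β) (hγ : 0 < γ) {ε δ τ : ℝ}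
    (hε : ε ∈ ({1, -1} : Set ℝ)) (hδ : δ ∈ ({1, -1} : Set ℝ)) (hτ : τ ∈ ({1, -1} : Set ℝ))
    {ξ : VField} {η : OneForm} {φ : EndField}
    (h : ∀ g, ξ g = ε • xi α β γ g ∧ η g = ε • eta α β γ g ∧ φ g = δ • phi α β γ τ g) :
    IsStandard α ε δ (δ * τ) ξ η φ where
  sign_eps := hε
  sign_a := hδ
  sign_b := by rcases hδ with rfl | rfl <;> rcases hτ with rfl | rfl <;> simp
  xi_apply g := by
    rw [(h g).1, xi_apply]
    ext i
    fin_cases i <;> simp [div_eq_mul_inv]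
  eta_apply g v := by
    rw [(h g).2.1, LinearMap.smul_apply, eta_apply, smul_eq_mul, mul_assoc]
  phi_apply g v := by
    rw [(h g).2.2, LinearMap.smul_apply, phi_apply α hβ hγ]
    ext i
    fin_cases i <;> simp [mul_assoc]

theorem isStandard_phi {α β γ : ℝ} (hβ : 0 < β) (hγ : 0 < γ) :
    IsStandard α 1 1 1 (xi α β γ) (eta α β γ) (phi α β γ 1) := by
  have := isStandard_of_eq (α := α) (τ := 1) hβ hγ (Set.mem_insert 1 {-1})
    (Set.mem_insert 1 {-1}) (Set.mem_insert 1 {-1}) (ξ := xi α β γ) (η := eta α β γ)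
    (φ := phi α β γ 1) (fun g => ⟨(one_smul _ _).symm, (one_smul _ _).symm, (one_smul _ _).symm⟩)
  rwa [mul_one] at this

namespace IsStandard

variable {α ε a b : ℝ} {ξ : VField} {η : OneForm} {φ : EndField}

theorem sq_eps (hS : IsStandard α ε a b ξ η φ) : ε * ε = 1 := by
  rcases hS.sign_eps with h | h <;> rw [h] <;> norm_num

theorem sq_a (hS : IsStandard α ε a b ξ η φ) : a * a = 1 := by
  rcases hS.sign_a with h | h <;> rw [h] <;> norm_num

theorem sq_b (hS : IsStandard α ε a b ξ η φ) : b * b = 1 := by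
  rcases hS.sign_b with h | h <;> rw [h] <;> norm_num

theorem isAlmostContactMetric (hα : 0 < α) (β γ : ℝ) (hS : IsStandard α ε a b ξ η φ) :
    IsAlmostContactMetric α β γ ξ η φ := by
  have hε := hS.sq_eps
  have ha := hS.sq_a
  have hb := hS.sq_b
  have h1 : √α ≠ 0 := (Real.sqrt_pos.2 hα).ne'
  have h2 : √α * √α = α := Real.mul_self_sqrt hα.le
  refine ⟨fun g => ?_, fun g v => ?_, fun g v w => ?_⟩
  · rw [hS.eta_apply, hS.xi_apply]
    simp
    field_simp
    linarith
  · rw [hS.eta_apply, hS.xi_apply, hS.phi_apply, hS.phi_apply]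
    ext i
    fin_cases i <;> simp
    · field_simp
      linear_combination -v 0 * hε
    · linear_combination v 1 * ha
    · linear_combination v 2 * ha
    · linear_combination v 3 * hb
    · linear_combination v 4 * hb
  · rw [hS.eta_apply, hS.eta_apply, hS.phi_apply, hS.phi_apply, metric_eq, metric_eq]
    simp
    linear_combination β * (v 1 * w 1 + v 2 * w 2) * ha + γ * (v 3 * w 3 + v 4 * w 4) * hb
      + v 0 * w 0 * (ε * ε * h2 + α * hε)

theorem isInvariantACM (hα : 0 < α) (β γ : ℝ) (hS : IsStandard α ε a b ξ η φ) :
    IsInvariantACM α β γ ξ η φ := by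
  refine ⟨fun g g' => ?_, fun g g' => ?_, fun g g' => ?_, hS.isAlmostContactMetric hα β γ⟩
  · rw [hS.xi_apply, hS.xi_apply]
  · exact LinearMap.ext fun v => by rw [hS.eta_apply, hS.eta_apply]
  · exact LinearMap.ext fun v => by rw [hS.phi_apply, hS.phi_apply]

theorem canon_xi (hS : IsStandard α ε a b ξ η φ) (X : VField) (g : G) : canon X ξ g = 0 := by
  change deriv _ _ = _
  simp only [hS.xi_apply]
  exact deriv_const _ _

theorem D_eta (hS : IsStandard α ε a b ξ η φ) (X Y : VField) (g : G) :
    X.D (η.app Y) g = η g (canon X Y g) := by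
  have h : η.app Y = fun g' => η g (Y g') := funext fun g' => by
    rw [OneForm.app, hS.eta_apply, hS.eta_apply]
  rw [h, D_linear]

theorem canon_phi (hS : IsStandard α ε a b ξ η φ) (X Y : VField) (g : G) :
    canon X (φ.app Y) g = φ g (canon X Y g) := by
  have h : ∀ g', φ.app Y g' = φ g (Y g') := fun g' => by
    change φ g' (Y g') = _
    rw [hS.phi_apply, hS.phi_apply]
  change deriv _ _ = _
  simp only [h]
  exact ((LinearMap.toContinuousLinearMap (φ g)).hasFDerivAt.comp_hasDerivAt (0 : ℝ)
    (canon_hasDerivAt X Y g)).deriv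

theorem dOne_eq (hS : IsStandard α ε a b ξ η φ) (X Y : VField) (g : G) :
    dOne η X Y g = -η g (brM (X g) (Y g)) := by
  rw [dOne, hS.D_eta, hS.D_eta, OneForm.app, bracket_apply, map_add, map_sub]
  ring

/-- As `φ` is parallel for `canon`, only `brM` survives. In each plane `φ` preserves the bracket,
which points along `e₁`; and `brM (e₁, ·)` commutes with `φ`. -/
theorem isNormal (hα : 0 < α) (hS : IsStandard α ε a b ξ η φ) : IsNormal ξ η φ := by
  intro X Y g
  have h : nijenhuis ξ η φ X Y g = brM (φ g (X g)) (φ g (Y g)) - φ g (brM (X g) (φ g (Y g)))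
      - φ g (brM (φ g (X g)) (Y g)) + φ g (φ g (brM (X g) (Y g)))
      - η g (brM (X g) (Y g)) • ξ g := by
    have happ : ∀ X : VField, φ.app X g = φ g (X g) := fun _ => rfl
    rw [nijenhuis, hS.dOne_eq]
    simp only [bracket_apply, hS.canon_phi, happ, map_add, map_sub, neg_smul]
    abel
  rw [h]
  generalize X g = x
  generalize Y g = y
  have hε := hS.sq_eps
  have h1 : √α ≠ 0 := (Real.sqrt_pos.2 hα).ne'
  have h2 : ∀ r : ℝ, ε * √α * r * (ε / √α) = r := fun r => by
    field_simp
    linear_combination r * hε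
  simp only [hS.phi_apply, hS.eta_apply, hS.xi_apply, brM_apply]
  rcases hS.sign_a with rfl | rfl <;> rcases hS.sign_b with rfl | rfl <;> ext i <;>
    fin_cases i <;> simp [h2] <;> ring

theorem dTwo_fundForm (β γ : ℝ) (hS : IsStandard α ε a b ξ η φ) (X Y Z : VField) (g : G) :
    dTwo (fundForm α β γ φ) X Y Z g = 0 := by
  have h1 : ∀ X Y Z : VField, X.D (fundForm α β γ φ Y Z) g =
      metric α β γ (canon X Y g) (φ g (Z g)) + metric α β γ (Y g) (φ g (canon X Z g)) := by
    intro X Y Z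
    rw [← hS.canon_phi]
    exact D_metricF α β γ X Y (φ.app Z) g
  have h2 : ∀ X Y : VField, fundForm α β γ φ X Y g = metric α β γ (X g) (φ g (Y g)) :=
    fun _ _ => rfl
  have h3 : ∀ v w, metric α β γ v (φ g w) = -metric α β γ w (φ g v) := by
    intro v w
    simp only [hS.phi_apply, metric_eq]
    simp
    ring
  have h4 : metric α β γ (brM (X g) (Y g)) (φ g (Z g)) + metric α β γ (brM (Y g) (Z g)) (φ g (X g))
      + metric α β γ (brM (Z g) (X g)) (φ g (Y g)) = 0 := by
    simp only [hS.phi_apply, metric_eq, brM_apply]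
    simp
    ring
  -- Since `φ` is skew, the `canon` terms of the six summands cancel in pairs, and the cyclic sum
  -- `h4` is what remains.
  simp only [dTwo, h1, h2, bracket_apply, metric_add_left, metric_sub_left]
  rw [h3 (Y g), h3 (Z g), h3 (X g)]
  linarith

end IsStandard

theorem eq_sum_single (P : Mm) : P = P 0 • (Pi.single 0 1 : Mm) + P 1 • (Pi.single 1 1 : Mm)
    + P 2 • (Pi.single 2 1 : Mm) + P 3 • (Pi.single 3 1 : Mm) + P 4 • (Pi.single 4 1 : Mm) := by
  ext i
  fin_cases i <;> simp

/-- An endomorphism of `𝔪` that commutes with the isotropy representation. -/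
theorem commutant_eq {f : Mm →ₗ[ℝ] Mm} {h : (3 / 5 : ℝ) ^ 2 + (4 / 5) ^ 2 = 1}
    (hf : ∀ v, f (isotropy (irEmbed (rot (3 / 5) (4 / 5) h)) v) =
      isotropy (irEmbed (rot (3 / 5) (4 / 5) h)) (f v)) :
    ∃ p u a u' b, ∀ v, f v =
      ![p * v 0, u * v 1 + a * v 2, u * v 2 - a * v 1, u' * v 3 - b * v 4, u' * v 4 + b * v 3] := by
  -- The rotation with cosine 3/5 has infinite order, so its eigenvalues `1`, `e^{±iθ}`, `e^{±2iθ}`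
  -- are distinct. Commuting with this single element already forces the block form, which is read
  -- off on the basis vectors by linear elimination.
  simp only [isotropy_rot] at hf
  have e0 := hf (Pi.single 0 1)
  have e1 := hf (Pi.single 1 1)
  have e2 := hf (Pi.single 2 1)
  have e3 := hf (Pi.single 3 1)
  have e4 := hf (Pi.single 4 1)
  rw [eq_sum_single (![_, _, _, _, _] : Mm)] at e0 e1 e2 e3 e4
  simp only [map_add, map_smul] at e0 e1 e2 e3 e4
  refine ⟨f (Pi.single 0 1) 0, f (Pi.single 1 1) 1, f (Pi.single 2 1) 1,
    f (Pi.single 3 1) 3, f (Pi.single 3 1) 4, fun v => ?_⟩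
  conv_lhs => rw [eq_sum_single v]
  simp only [map_add, map_smul]
  generalize f (Pi.single 0 1) = P0 at *
  generalize f (Pi.single 1 1) = P1 at *
  generalize f (Pi.single 2 1) = P2 at *
  generalize f (Pi.single 3 1) = P3 at *
  generalize f (Pi.single 4 1) = P4 at *
  simp [funext_iff, Fin.forall_fin_succ] at e0 e1 e2 e3 e4
  obtain ⟨a1, a2, a3, a4⟩ := e0
  obtain ⟨b0, b1, b2, b3, b4⟩ := e1
  obtain ⟨c0, c1, c2, c3, c4⟩ := e2
  obtain ⟨d0, d1, d2, d3, d4⟩ := e3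
  obtain ⟨f0, f1, f2, f3, f4⟩ := e4
  have x1 : P0 1 = 0 := by linarith only [a1, a2]
  have x2 : P0 2 = 0 := by linarith only [a1, a2]
  have x3 : P0 3 = 0 := by linarith only [a3, a4]
  have x4 : P0 4 = 0 := by linarith only [a3, a4]
  have y0 : P1 0 = 0 := by linarith only [b0, c0]
  have y2 : P1 2 = -P2 1 := by linarith only [b1]
  have y3 : P1 3 = 0 := by linarith only [b3, b4, c3, c4]
  have y4 : P1 4 = 0 := by linarith only [b3, b4, c3, c4]
  have z0 : P2 0 = 0 := by linarith only [b0, c0]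
  have z2 : P2 2 = P1 1 := by linarith only [b2]
  have z3 : P2 3 = 0 := by linarith only [b3, b4, c3, c4]
  have z4 : P2 4 = 0 := by linarith only [b3, b4, c3, c4]
  have u0 : P3 0 = 0 := by linarith only [d0, f0]
  have u1 : P3 1 = 0 := by linarith only [d1, d2, f1, f2]
  have u2 : P3 2 = 0 := by linarith only [d1, d2, f1, f2]
  have w0 : P4 0 = 0 := by linarith only [d0, f0]
  have w1 : P4 1 = 0 := by linarith only [d1, d2, f1, f2]
  have w2 : P4 2 = 0 := by linarith only [d1, d2, f1, f2]
  have w3 : P4 3 = -P3 4 := by linarith only [d3]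
  have w4 : P4 4 = P3 3 := by linarith only [d4]
  rw [show P0 = ![P0 0, 0, 0, 0, 0] by ext i; fin_cases i <;> simp [x1, x2, x3, x4],
    show P1 = ![0, P1 1, -P2 1, 0, 0] by ext i; fin_cases i <;> simp [y0, y2, y3, y4],
    show P2 = ![0, P2 1, P1 1, 0, 0] by ext i; fin_cases i <;> simp [z0, z2, z3, z4],
    show P3 = ![0, 0, 0, P3 3, P3 4] by ext i; fin_cases i <;> simp [u0, u1, u2],
    show P4 = ![0, 0, 0, -P3 4, P3 3] by ext i; fin_cases i <;> simp [w0, w1, w2, w3, w4]]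
  clear * -
  ext i
  fin_cases i <;> simp <;> ring

theorem IsInvariantACM.exists_isStandard {α β γ : ℝ} (hα : 0 < α) {ξ : VField} {η : OneForm}
    {φ : EndField} (h : IsInvariantACM α β γ ξ η φ) : ∃ ε a b, IsStandard α ε a b ξ η φ := by
  obtain ⟨iξ, iη, iφ, hA⟩ := h
  have cξ : ∀ g, ξ g = ξ 1 := fun g => by simpa using iξ g 1
  have cη : ∀ g, η g = η 1 := fun g => by simpa using iη g 1
  have cφ : ∀ g, φ g = φ 1 := fun g => by simpa using iφ g 1
  have hrot : ((3 / 5 : ℝ)) ^ 2 + (4 / 5) ^ 2 = 1 := by norm_num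
  set k : G := irEmbed (rot (3 / 5) (4 / 5) hrot) with hk
  have hkH : k⁻¹ ∈ H := H.inv_mem ⟨_, rfl⟩
  have eξ := ξ.equivariant 1 _ hkH
  have eη := η.equivariant 1 _ hkH
  have eφ := φ.equivariant 1 _ hkH
  rw [inv_inv] at eξ
  simp only [inv_inv] at eη eφ
  rw [cξ] at eξ
  rw [cη] at eη
  rw [cφ] at eφ
  obtain ⟨p, u, a, u', b, hφ⟩ := commutant_eq eφ
  simp only [hk, isotropy_rot] at eξ eη
  have hξ : ξ 1 = ![ξ 1 0, 0, 0, 0, 0] := by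
    have e1 := congrFun eξ 1
    have e2 := congrFun eξ 2
    have e3 := congrFun eξ 3
    have e4 := congrFun eξ 4
    simp at e1 e2 e3 e4
    ext i
    fin_cases i <;> simp <;> linarith
  have hη : ∀ v, η 1 v = η 1 (Pi.single 0 1) * v 0 := by
    have s1 : η 1 (Pi.single 1 1) = 0 ∧ η 1 (Pi.single 2 1) = 0 ∧ η 1 (Pi.single 3 1) = 0 ∧
        η 1 (Pi.single 4 1) = 0 := by
      have e1 := eη (Pi.single 1 1)
      have e2 := eη (Pi.single 2 1)
      have e3 := eη (Pi.single 3 1)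
      have e4 := eη (Pi.single 4 1)
      rw [eq_sum_single ![_, _, _, _, _]] at e1 e2 e3 e4
      simp only [map_add, map_smul] at e1 e2 e3 e4
      simp at e1 e2 e3 e4
      refine ⟨?_, ?_, ?_, ?_⟩ <;> linarith
    intro v
    conv_lhs => rw [eq_sum_single v]
    simp only [map_add, map_smul, s1]
    simp [mul_comm]
  have hηξ := hA.eta_xi 1
  rw [hη] at hηξ
  set n := η 1 (Pi.single 0 1) with hn
  have sq0 := congrFun (hA.phi_sq 1 (Pi.single 0 1)) 0
  have sq1 := hA.phi_sq 1 (Pi.single 1 1)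
  have sq11 := congrFun sq1 1
  have sq12 := congrFun sq1 2
  have sq3 := hA.phi_sq 1 (Pi.single 3 1)
  have sq33 := congrFun sq3 3
  have sq34 := congrFun sq3 4
  have m0 := hA.metric_phi 1 (Pi.single 0 1) (Pi.single 0 1)
  rw [hφ, hη] at sq0 sq11 sq12 sq33 sq34 m0
  rw [hξ] at sq11 sq12 sq33 sq34
  simp [hφ, metric_eq] at sq0 sq11 sq12 sq33 sq34 m0
  have hp : p = 0 := by
    have : p * p = 0 := by linarith
    simpa using this
  have hn2 : n * n = α := by
    rw [hp] at m0
    linarith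
  -- On the first plane `φ² = -1` reads `u² - a² = -1` and `u a = 0`; the second plane is analogous.
  have ha0 : a ≠ 0 := by
    rintro rfl
    nlinarith [mul_self_nonneg u]
  have hb0 : b ≠ 0 := by
    rintro rfl
    nlinarith [mul_self_nonneg u']
  have hu : u = 0 := by
    have : u * a = 0 := by linarith
    simpa [ha0] using this
  have hu' : u' = 0 := by
    have : u' * b = 0 := by linarith
    simpa [hb0] using this
  subst hp hu hu'
  have ha : a = 1 ∨ a = -1 := mul_self_eq_one_iff.1 (by linarith)
  have hb : b = 1 ∨ b = -1 := mul_self_eq_one_iff.1 (by linarith)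
  have h1 : √α ≠ 0 := (Real.sqrt_pos.2 hα).ne'
  have h2 : √α * √α = α := Real.mul_self_sqrt hα.le
  have hε : n / √α = 1 ∨ n / √α = -1 := mul_self_eq_one_iff.1 (by
    rw [div_mul_div_comm, h2, hn2, div_self hα.ne'])
  refine ⟨n / √α, a, b, hε, ha, hb, fun g => ?_, fun g v => ?_, fun g v => ?_⟩
  · rw [cξ, hξ]
    have : ξ 1 0 = n / √α / √α := by
      rw [div_div, h2, eq_div_iff hα.ne', ← hn2]
      linear_combination n * hηξ
    rw [this]
  · rw [cη, hη, div_mul_cancel₀ _ h1]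
  · rw [cφ, hφ]
    ext i
    fin_cases i <;> simp

theorem isInvariantACM_iff {α β γ : ℝ} (hα : 0 < α) (hβ : 0 < β) (hγ : 0 < γ) (ξ : VField)
    (η : OneForm) (φ : EndField) :
    IsInvariantACM α β γ ξ η φ ↔
      ∃ ε ∈ ({1, -1} : Set ℝ), ∃ δ ∈ ({1, -1} : Set ℝ), ∃ τ ∈ ({1, -1} : Set ℝ),
        ∀ g, ξ g = ε • xi α β γ g ∧ η g = ε • eta α β γ g ∧ φ g = δ • phi α β γ τ g := by
  constructor
  · intro h
    obtain ⟨ε, a, b, hS⟩ := h.exists_isStandard hα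
    -- With `δ = a`, the coefficient `b` of `E₄₅` must equal `δ τ`; as `a² = 1`, this gives `τ = a
    -- b`.
    refine ⟨ε, hS.sign_eps, a, hS.sign_a, a * b, ?_, fun g => ⟨?_, ?_, ?_⟩⟩
    · rcases hS.sign_a with h | h <;> rcases hS.sign_b with h' | h' <;> simp [h, h']
    · rw [hS.xi_apply, xi_apply]
      ext i
      fin_cases i <;> simp [div_eq_mul_inv]
    · refine LinearMap.ext fun v => ?_
      rw [hS.eta_apply, LinearMap.smul_apply, eta_apply, smul_eq_mul, mul_assoc]
    · refine LinearMap.ext fun v => ?_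
      have ha := hS.sq_a
      rw [hS.phi_apply, LinearMap.smul_apply, phi_apply α hβ hγ]
      ext i
      fin_cases i <;> simp [← mul_assoc, ha]
  · rintro ⟨ε, hε, δ, hδ, τ, hτ, h⟩
    exact (isStandard_of_eq hβ hγ hε hδ hτ h).isInvariantACM hα β γ

theorem phi_one_ne {β γ : ℝ} (α : ℝ) (hβ : 0 < β) (hγ : 0 < γ) (g : G) :
    phi α β γ 1 g ≠ phi α β γ (-1) g ∧ phi α β γ 1 g ≠ -phi α β γ (-1) g := by
  constructor
  · intro h
    have := congrFun (LinearMap.congr_fun h (Pi.single 3 1)) 4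
    rw [phi_apply α hβ hγ, phi_apply α hβ hγ] at this
    simp at this
    norm_num at this
  · intro h
    have := congrFun (LinearMap.congr_fun h (Pi.single 1 1)) 2
    rw [LinearMap.neg_apply, phi_apply α hβ hγ, phi_apply α hβ hγ] at this
    simp at this
    norm_num at this

/-! ### The characteristic connection -/

/-- The difference of the characteristic connection and the canonical connection: `e₁` acts as a
rotation with speeds `p` and `q` in the planes `e₂, e₃` and `e₄, e₅`. -/
def rotB (p q : ℝ) : Mm →ₗ[ℝ] Mm →ₗ[ℝ] Mm :=
  LinearMap.mk₂ ℝ (fun v w =>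
    ![0, -(p * v 0 * w 2), p * v 0 * w 1, -(q * v 0 * w 4), q * v 0 * w 3])
    (fun _ _ _ => by ext i; fin_cases i <;> simp <;> ring)
    (fun _ _ _ => by ext i; fin_cases i <;> simp <;> ring)
    (fun _ _ _ => by ext i; fin_cases i <;> simp <;> ring)
    (fun _ _ _ => by ext i; fin_cases i <;> simp <;> ring)

theorem rotB_apply (p q : ℝ) (v w : Mm) : rotB p q v w =
    ![0, -(p * v 0 * w 2), p * v 0 * w 1, -(q * v 0 * w 4), q * v 0 * w 3] := rfl

theorem rotB_isEquivariant (p q : ℝ) : IsEquivariant (rotB p q) := by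
  rintro _ ⟨A, rfl⟩ v w
  obtain ⟨c, s, h, rfl⟩ := exists_rot A
  rw [isotropy_rot, isotropy_rot, isotropy_rot, rotB_apply, rotB_apply]
  ext i
  fin_cases i <;> simp <;> ring

/-- The characteristic connection of the invariant almost contact metric structures. -/
def charConn (α β γ : ℝ) : VField → VField → VField :=
  conn (rotB (2 * α / (5 * β) - 2) (1 - α / (5 * γ))) (rotB_isEquivariant _ _)

theorem charConn_apply (α β γ : ℝ) (X Y : VField) (g : G) : charConn α β γ X Y g =
    canon X Y g + rotB (2 * α / (5 * β) - 2) (1 - α / (5 * γ)) (X g) (Y g) := rfl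

theorem charConn_isMetricConnection (α β γ : ℝ) :
    IsMetricConnection α β γ (charConn α β γ) := by
  refine conn_isMetricConnection _ fun x y z => ?_
  rw [metric_eq, metric_eq, rotB_apply, rotB_apply]
  simp
  ring

/-- The speeds `p`, `q` are fixed here: skewness requires `β (p + 2) = 2α/5` and `γ (q - 1) = -α/5`,
the right-hand sides coming from the `e₁`-component of `brM`. -/
theorem charConn_torsion3 {α β γ : ℝ} (hβ : 0 < β) (hγ : 0 < γ) (X Y Z : VField) (g : G) :
    torsion3 α β γ (charConn α β γ) X Y Z g =
      2 * α / 5 * (X g 0 * (Y g 1 * Z g 2 - Y g 2 * Z g 1)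
        + Y g 0 * (Z g 1 * X g 2 - Z g 2 * X g 1) + Z g 0 * (X g 1 * Y g 2 - X g 2 * Y g 1))
      - α / 5 * (X g 0 * (Y g 3 * Z g 4 - Y g 4 * Z g 3)
        + Y g 0 * (Z g 3 * X g 4 - Z g 4 * X g 3) + Z g 0 * (X g 3 * Y g 4 - X g 4 * Y g 3)) := by
  rw [torsion3, charConn, conn_torsion, metric_eq, rotB_apply, rotB_apply, brM_apply]
  simp
  field_simp
  ring

theorem charConn_hasSkewTorsion {α β γ : ℝ} (hβ : 0 < β) (hγ : 0 < γ) :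
    HasSkewTorsion α β γ (charConn α β γ) := by
  intro X Y Z g
  rw [charConn_torsion3 hβ hγ, charConn_torsion3 hβ hγ]
  ring

theorem wedge3_eq (α β γ : ℝ) (hα : 0 < α) (hβ : 0 < β) (hγ : 0 < γ) (u v w : Mm) :
    2 * √α / (5 * β) * wedge3 α β γ 0 1 2 u v w - √α / (5 * γ) * wedge3 α β γ 0 3 4 u v w =
      2 * α / 5 * (u 0 * (v 1 * w 2 - v 2 * w 1)
        + v 0 * (w 1 * u 2 - w 2 * u 1) + w 0 * (u 1 * v 2 - u 2 * v 1))
      - α / 5 * (u 0 * (v 3 * w 4 - v 4 * w 3)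
        + v 0 * (w 3 * u 4 - w 4 * u 3) + w 0 * (u 3 * v 4 - u 4 * v 3)) := by
  obtain ⟨d, hd, rfl⟩ : ∃ d, 0 < d ∧ α = d ^ 2 :=
    ⟨√α, Real.sqrt_pos.2 hα, (Real.sq_sqrt hα.le).symm⟩
  obtain ⟨b, hb, rfl⟩ : ∃ d, 0 < d ∧ β = d ^ 2 :=
    ⟨√β, Real.sqrt_pos.2 hβ, (Real.sq_sqrt hβ.le).symm⟩
  obtain ⟨c, hc, rfl⟩ : ∃ d, 0 < d ∧ γ = d ^ 2 :=
    ⟨√γ, Real.sqrt_pos.2 hγ, (Real.sq_sqrt hγ.le).symm⟩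
  simp [wedge3, Matrix.det_fin_three, eDual, weight, Real.sqrt_sq hd.le, Real.sqrt_sq hb.le,
    Real.sqrt_sq hc.le]
  field_simp
  ring

namespace IsStandard

variable {α ε a b : ℝ} {ξ : VField} {η : OneForm} {φ : EndField}

theorem etaWedgeDEta_eq (hα : 0 < α) (hS : IsStandard α ε a b ξ η φ) (X Y Z : VField) (g : G) :
    etaWedgeDEta η X Y Z g =
      2 * α / 5 * (X g 0 * (Y g 1 * Z g 2 - Y g 2 * Z g 1)
        + Y g 0 * (Z g 1 * X g 2 - Z g 2 * X g 1) + Z g 0 * (X g 1 * Y g 2 - X g 2 * Y g 1))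
      - α / 5 * (X g 0 * (Y g 3 * Z g 4 - Y g 4 * Z g 3)
        + Y g 0 * (Z g 3 * X g 4 - Z g 4 * X g 3) + Z g 0 * (X g 3 * Y g 4 - X g 4 * Y g 3)) := by
  have h1 : ε * √α * (ε * √α) = α := by
    rw [mul_mul_mul_comm, hS.sq_eps, Real.mul_self_sqrt hα.le, one_mul]
  simp only [etaWedgeDEta, OneForm.app, hS.dOne_eq, hS.eta_apply, brM_apply, Matrix.cons_val_zero]
  linear_combination (2 / 5 * (X g 0 * (Y g 1 * Z g 2 - Y g 2 * Z g 1)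
        + Y g 0 * (Z g 1 * X g 2 - Z g 2 * X g 1) + Z g 0 * (X g 1 * Y g 2 - X g 2 * Y g 1))
      - 1 / 5 * (X g 0 * (Y g 3 * Z g 4 - Y g 4 * Z g 3)
        + Y g 0 * (Z g 3 * X g 4 - Z g 4 * X g 3) + Z g 0 * (X g 3 * Y g 4 - X g 4 * Y g 3))) * h1

theorem isContactCharacteristic {β γ : ℝ} (hβ : 0 < β) (hγ : 0 < γ)
    (hS : IsStandard α ε a b ξ η φ) : IsContactCharacteristic α β γ ξ η φ (charConn α β γ) := by
  refine ⟨charConn_isMetricConnection α β γ, charConn_hasSkewTorsion hβ hγ, fun X g => ?_,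
    fun X Y g => ?_, fun X Y g => ?_⟩
  · rw [charConn_apply, hS.canon_xi, hS.xi_apply, rotB_apply]
    ext i
    fin_cases i <;> simp
  · rw [hS.D_eta, OneForm.app, charConn_apply, hS.eta_apply, hS.eta_apply, rotB_apply]
    simp
  · rw [charConn_apply, charConn_apply, hS.canon_phi, map_add]
    congr 1
    change rotB _ _ (X g) (φ g (Y g)) = _
    rw [rotB_apply, rotB_apply, hS.phi_apply, hS.phi_apply]
    ext i
    fin_cases i <;> simp <;> ring

theorem contactCharacteristic_unique {β γ : ℝ} (hα : 0 < α) (hβ : 0 < β) (hγ : 0 < γ)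
    (hS : IsStandard α ε a b ξ η φ) {nabla nabla' : VField → VField → VField}
    (h : IsContactCharacteristic α β γ ξ η φ nabla)
    (h' : IsContactCharacteristic α β γ ξ η φ nabla') : nabla = nabla' := by
  obtain ⟨hm, hs, hξ, -, hφ⟩ := h
  obtain ⟨hm', hs', hξ', -, hφ'⟩ := h'
  have skew2 := fun (X Y Z : VField) g => metric_difference hm hm' X Y Z g
  have skew1 := fun (X Y Z : VField) g => skew_difference hm hm' hs hs' X Y Z g
  have hA := hS.isAlmostContactMetric hα β γ
  have adj : ∀ g v w, metric α β γ (φ g v) w = -metric α β γ v (φ g w) := by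
    intro g v w
    rw [hS.phi_apply, hS.phi_apply, metric_eq, metric_eq]
    simp
    ring
  have phi23 : ∀ (X Y Z : VField) (g : G),
      metric α β γ (nabla X (φ.app Y) g - nabla' X (φ.app Y) g) (Z g) =
        -metric α β γ (nabla X Y g - nabla' X Y g) (φ.app Z g) := by
    intro X Y Z g
    rw [hφ, hφ', ← map_sub, adj]
    rfl
  -- The difference `S` is a 3-form, and passing `φ` from one slot to another changes its sign.
  -- Three passes bring `φ` back to its slot with sign `-1`.
  have zero_phi : ∀ (X Y Z : VField) (g : G),
      metric α β γ (nabla X Y g - nabla' X Y g) (φ.app Z g) = 0 := by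
    intro X Y Z g
    have a1 := phi23 X Y Z g
    have a2 := phi23 Y X Z g
    have a3 := skew1 X Y (φ.app Z) g
    have a4 := skew1 Y (φ.app X) Z g
    have a5 := skew2 (φ.app X) Y Z g
    have a6 := phi23 (φ.app X) Y Z g
    have a7 := skew1 (φ.app X) Y Z g
    have a8 := skew1 (φ.app X) Z Y g
    have a9 := phi23 Z X Y g
    have a10 := skew1 X (φ.app Y) Z g
    have a11 := skew2 (φ.app Y) X Z g
    have a12 := skew1 (φ.app Y) Z X g
    have a13 := skew2 Z X (φ.app Y) g
    linarith
  have zero_xi : ∀ (X Y : VField) (g : G),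
      metric α β γ (nabla X Y g - nabla' X Y g) (ξ g) = 0 := by
    intro X Y g
    rw [skew2, hξ, hξ', sub_self, metric_eq]
    simp
  have key : ∀ X Y Z : VField, ∀ g, metric α β γ (nabla X Y g - nabla' X Y g) (Z g) = 0 := by
    intro X Y Z g
    -- Every vector is the sum of a multiple of `ξ` and an element of the image of `φ`, so the two
    -- vanishing statements suffice.
    have h1 : Z g = η g (Z g) • ξ g - φ.app (φ.app Z) g := by
      change Z g = η g (Z g) • ξ g - φ g (φ g (Z g))
      rw [hA.phi_sq]
      abel
    have h2 : ∀ v w (c : ℝ), metric α β γ v (c • w) = c * metric α β γ v w := by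
      intro v w c
      simp only [metric_eq, Pi.smul_apply, smul_eq_mul]
      ring
    rw [h1, metric_sub_right, h2, zero_phi, zero_xi, mul_zero, sub_zero]
  funext X Y
  refine VField.ext (funext fun g => ?_)
  rw [← sub_eq_zero]
  refine eq_zero_of_metric_self hα hβ hγ ?_
  rw [metric_sub_right, key, key, sub_zero]

theorem isSasakian_iff {β γ : ℝ} (hα : 0 < α) (hβ : 0 < β) (hγ : 0 < γ)
    (hS : IsStandard α 1 1 1 ξ η φ) :
    IsSasakian α β γ ξ η φ ↔ α = 25 * β ^ 2 ∧ 25 * β ^ 2 = 100 * γ ^ 2 := by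
  have h1 : IsSasakian α β γ ξ η φ ↔ ∀ X Y g, 2 * fundForm α β γ φ X Y g = dOne η X Y g :=
    ⟨fun h => h.2.2, fun h => ⟨hS.isAlmostContactMetric hα β γ, hS.isNormal hα, h⟩⟩
  -- Both 2-forms are combinations of `e₂ ∧ e₃` and `e₄ ∧ e₅`; the two coefficients of the
  -- difference vanish exactly when `√α = 5β` and `√α = 10γ`.
  have h2 : ∀ X Y g, 2 * fundForm α β γ φ X Y g - dOne η X Y g =
      (2 * β - 2 / 5 * √α) * (X g 1 * Y g 2 - X g 2 * Y g 1)
        - (2 * γ - √α / 5) * (X g 3 * Y g 4 - X g 4 * Y g 3) := by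
    intro X Y g
    have h3 : fundForm α β γ φ X Y g = metric α β γ (X g) (φ g (Y g)) := rfl
    rw [h3, hS.dOne_eq, hS.eta_apply, hS.phi_apply, metric_eq, brM_apply]
    simp
    ring
  have h4 : √α ^ 2 = α := Real.sq_sqrt hα.le
  rw [h1]
  constructor
  · intro h
    obtain ⟨X1, hX1⟩ := exists_vField 1 (Pi.single 1 1)
    obtain ⟨X2, hX2⟩ := exists_vField 1 (Pi.single 2 1)
    obtain ⟨X3, hX3⟩ := exists_vField 1 (Pi.single 3 1)
    obtain ⟨X4, hX4⟩ := exists_vField 1 (Pi.single 4 1)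
    have k1 := h2 X1 X2 1
    have k2 := h2 X3 X4 1
    rw [h, sub_self, hX1, hX2] at k1
    rw [h, sub_self, hX3, hX4] at k2
    simp at k1 k2
    have m1 : √α = 5 * β := by linarith
    have m2 : √α = 10 * γ := by linarith
    constructor
    · rw [← h4, m1]; ring
    · have : 5 * β = 10 * γ := by linarith
      linear_combination (5 * β + 10 * γ) * this
  · rintro ⟨k1, k2⟩ X Y g
    have m1 : √α = 5 * β := by
      rw [k1, show 25 * β ^ 2 = (5 * β) ^ 2 by ring, Real.sqrt_sq (by positivity)]
    have m2 : √α = 10 * γ := by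
      rw [k1, k2, show 100 * γ ^ 2 = (10 * γ) ^ 2 by ring, Real.sqrt_sq (by positivity)]
    rw [← sub_eq_zero, h2]
    have e1 : 2 * β - 2 / 5 * √α = 0 := by linarith
    have e2 : 2 * γ - √α / 5 = 0 := by linarith
    rw [e1, e2]
    ring

end IsStandard

/-! ### The `SO(3)_ir` structure -/

/-- `Υ` is parallel for `canon`, so only the algebraic action of `b (X, ·)` on `Υ` remains. -/
theorem nablaUpsilon_conn (α β γ : ℝ) {b : Mm →ₗ[ℝ] Mm →ₗ[ℝ] Mm} (hb : IsEquivariant b)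
    (X Y Z W : VField) (g : G) : nablaUpsilon α β γ (conn b hb) X Y Z W g =
      -(upsilon α β γ (b (X g) (Y g)) (Z g) (W g) + upsilon α β γ (Y g) (b (X g) (Z g)) (W g)
        + upsilon α β γ (Y g) (Z g) (b (X g) (W g))) := by
  rw [nablaUpsilon, D_upsilonF, upsilonF, upsilonF, upsilonF, conn_apply, conn_apply, conn_apply]
  simp only [upsilon_eq, Pi.add_apply]
  ring

/-- The difference of the Levi-Civita connection and the canonical connection. -/
def leviCivitaB (p q : ℝ) : Mm →ₗ[ℝ] Mm →ₗ[ℝ] Mm :=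
  (1 / 2 : ℝ) • (rotB p q + (rotB p q).flip + brM)

theorem leviCivitaB_apply (p q : ℝ) (v w : Mm) :
    leviCivitaB p q v w = (1 / 2 : ℝ) • (rotB p q v w + rotB p q w v + brM v w) := rfl

theorem leviCivitaB_isEquivariant (p q : ℝ) : IsEquivariant (leviCivitaB p q) := by
  intro h hh v w
  rw [leviCivitaB_apply, leviCivitaB_apply, rotB_isEquivariant p q h hh,
    rotB_isEquivariant p q h hh, brM_isEquivariant h hh, ← isotropy_add hh, ← isotropy_add hh,
    isotropy_smul hh]

theorem brM_self (v : Mm) : brM v v = 0 := by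
  rw [brM_apply]
  ext i
  fin_cases i <;> simp <;> ring

theorem brM_skew (v w : Mm) : brM w v = -brM v w := by
  rw [brM_apply, brM_apply]
  ext i
  fin_cases i <;> simp <;> ring

/-- The Levi-Civita connection of `g_{αβγ}`. -/
def leviCivitaConn (α β γ : ℝ) : VField → VField → VField :=
  conn (leviCivitaB (2 * α / (5 * β) - 2) (1 - α / (5 * γ))) (leviCivitaB_isEquivariant _ _)

/-- This connection is `charConn` minus half its torsion, which is why the same speeds `p`, `q`
occur. -/
theorem leviCivitaConn_isLeviCivita {α β γ : ℝ} (hβ : 0 < β) (hγ : 0 < γ) :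
    IsLeviCivita α β γ (leviCivitaConn α β γ) := by
  refine ⟨conn_isMetricConnection _ fun x y z => ?_, fun X Y g => ?_⟩
  · simp only [metric_eq, leviCivitaB_apply, rotB_apply, brM_apply, Pi.smul_apply, Pi.add_apply,
      smul_eq_mul]
    simp
    field_simp
    ring
  · rw [leviCivitaConn, conn_torsion, leviCivitaB_apply, leviCivitaB_apply, brM_skew (X g) (Y g)]
    module

theorem isNearlyIntegrable_iff {α β γ : ℝ} (hα : 0 < α) (hβ : 0 < β) (hγ : 0 < γ) :
    IsNearlyIntegrable α β γ ↔ 1 - α / (5 * γ) = 2 * (2 * α / (5 * β) - 2) := by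
  set p := 2 * α / (5 * β) - 2 with hp
  set q := 1 - α / (5 * γ) with hq
  -- On the diagonal `brM` drops out and `leviCivitaB` equals `rotB`; the action of a rotation with
  -- speeds `p`, `q` on the cubic form is proportional to `q - 2 p`.
  have h1 : ∀ X g, nablaUpsilon α β γ (leviCivitaConn α β γ) X X X X g =
      -3 * (√3 * √β ^ 2 * √γ / 2) * (q - 2 * p) * (X g 0 * ((X g 1 ^ 2 - X g 2 ^ 2) * X g 3
        + 2 * X g 1 * X g 2 * X g 4)) := by
    intro X g
    rw [leviCivitaConn, nablaUpsilon_conn, leviCivitaB_apply, brM_self]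
    simp only [upsilon_eq, rotB_apply, Pi.smul_apply, Pi.add_apply, smul_eq_mul, Pi.zero_apply]
    simp
    ring
  constructor
  · rintro ⟨nabla, hn, h⟩
    rw [leviCivita_unique hα hβ hγ hn (leviCivitaConn_isLeviCivita hβ hγ)] at h
    -- The cubic factor `x₀ ((x₁² - x₂²) x₃ + 2 x₁ x₂ x₄)` is 1 at this vector.
    obtain ⟨X, hX⟩ := exists_vField 1 ![1, 1, 0, 1, 0]
    have h2 := h1 X 1
    rw [h, hX] at h2
    have h3 : √3 * √β ^ 2 * √γ / 2 ≠ 0 := by positivity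
    have h4 : -3 * (√3 * √β ^ 2 * √γ / 2) * (q - 2 * p) = 0 := by
      simpa using h2.symm
    have h5 : q - 2 * p = 0 := by
      rcases mul_eq_zero.1 h4 with h | h
      · rcases mul_eq_zero.1 h with h | h
        · norm_num at h
        · exact absurd h h3
      · exact h
    linarith
  · intro h
    refine ⟨_, leviCivitaConn_isLeviCivita hβ hγ, fun X g => ?_⟩
    rw [h1, h]
    ring

/-- For `q = 2 p` the term `rotB` rotates the planes in the ratio 1 : 2, as the isotropy algebra
does, and that algebra preserves `Υ`. -/
theorem charConn_isIrCharacteristic {α β γ : ℝ} (hα : 0 < α) (hβ : 0 < β) (hγ : 0 < γ)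
    (h : IsNearlyIntegrable α β γ) : IsIrCharacteristic α β γ (charConn α β γ) := by
  rw [isNearlyIntegrable_iff hα hβ hγ] at h
  refine ⟨charConn_isMetricConnection α β γ, charConn_hasSkewTorsion hβ hγ,
    fun X Y Z W g => ?_⟩
  rw [charConn, nablaUpsilon_conn]
  simp only [h]
  generalize 2 * α / (5 * β) - 2 = p
  simp only [upsilon_eq, rotB_apply]
  simp
  ring

/-! ### Uniqueness of the characteristic connection of `Υ` -/

/-- Relations in the stabilizer algebra of `Υ` in `so(5)`. -/
theorem stabilizer_upsilon {α β γ : ℝ} (hα : 0 < α) (hβ : 0 < β) (hγ : 0 < γ)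
    {a : Fin 5 → Mm} {T : Fin 5 → Fin 5 → ℝ} (hT : ∀ j k, T j k = weight α β γ k * a j k)
    (hs : ∀ j k, T j k = -T k j)
    (hU : ∀ j l m, upsilon α β γ (a j) (Pi.single l 1) (Pi.single m 1)
      + upsilon α β γ (Pi.single j 1) (a l) (Pi.single m 1)
      + upsilon α β γ (Pi.single j 1) (Pi.single l 1) (a m) = 0) :
    T 0 3 = 0 ∧ T 0 4 = 0 ∧ (T 0 1 = 0 → T 2 3 = 0) ∧ (T 0 2 = 0 → T 2 4 = 0) ∧
      (T 1 2 = 0 ↔ T 3 4 = 0) := by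
  have hd := Real.sqrt_pos.2 hα
  have hb := Real.sqrt_pos.2 hβ
  have hc := Real.sqrt_pos.2 hγ
  have h3 : (0 : ℝ) < √3 := by positivity
  have w0 : ∀ j, T j 0 = √α ^ 2 * a j 0 := fun j => by rw [hT, Real.sq_sqrt hα.le]; rfl
  have w1 : ∀ j, T j 1 = √β ^ 2 * a j 1 := fun j => by rw [hT, Real.sq_sqrt hβ.le]; rfl
  have w2 : ∀ j, T j 2 = √β ^ 2 * a j 2 := fun j => by rw [hT, Real.sq_sqrt hβ.le]; rfl
  have w3 : ∀ j, T j 3 = √γ ^ 2 * a j 3 := fun j => by rw [hT, Real.sq_sqrt hγ.le]; rfl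
  have w4 : ∀ j, T j 4 = √γ ^ 2 * a j 4 := fun j => by rw [hT, Real.sq_sqrt hγ.le]; rfl
  -- These five components of the invariance equation suffice. The coefficients below eliminate the
  -- entries of `a` in favour of `T`.
  have u003 := hU 0 0 3
  have u004 := hU 0 0 4
  have u023 := hU 0 2 3
  have u024 := hU 0 2 4
  have u113 := hU 1 1 3
  simp [upsilon_eq] at u003 u004 u023 u024 u113
  generalize √α = d at *
  generalize √β = b at *
  generalize √γ = c at *
  generalize √3 = r at *
  have t03 : T 0 3 = 0 := by
    have : d * T 0 3 = 0 := by
      linear_combination -1 / 3 * u003 + 2 / 3 * d * w3 0 + 1 / 3 * d * hs 0 3 - 1 / 3 * d * w0 3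
    simpa [hd.ne'] using this
  have t04 : T 0 4 = 0 := by
    have : d * T 0 4 = 0 := by
      linear_combination -1 / 3 * u004 + 2 / 3 * d * w4 0 + 1 / 3 * d * hs 0 4 - 1 / 3 * d * w0 4
    simpa [hd.ne'] using this
  refine ⟨t03, t04, fun h => ?_, fun h => ?_, fun h => ?_, fun h => ?_⟩
  · have : d * T 2 3 = 0 := by
      linear_combination -2 / 3 * u023 + 2 / 3 * d * w3 2 + 1 / 3 * d * hs 2 3 - 1 / 3 * d * w2 3
        + r * c / 3 * w1 0 - r * c / 3 * h
    simpa [hd.ne'] using this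
  · have : d * T 2 4 = 0 := by
      linear_combination -2 / 3 * u024 + 2 / 3 * d * w4 2 + 1 / 3 * d * hs 2 4 - 1 / 3 * d * w2 4
        + r * c / 3 * w2 0 - r * c / 3 * h
    simpa [hd.ne'] using this
  -- The underlying relation is `β * T 3 4 = 2 * γ * T 1 2`, the ratio 1 : 2 of the isotropy
  -- weights.
  · have : d * r * b ^ 2 * T 3 4 = 0 := by
      linear_combination 2 * c * d * u113 + d * r * b ^ 2 * w4 3 - 2 * d * r * c ^ 2 * w2 1
        + 2 * d * r * c ^ 2 * h + c * b ^ 2 * (w0 3 - hs 0 3 + t03)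
    simpa [hd.ne', h3.ne', hb.ne'] using this
  · have : d * r * c ^ 2 * T 1 2 = 0 := by
      linear_combination -c * d * u113 - 1 / 2 * d * r * b ^ 2 * w4 3 + d * r * c ^ 2 * w2 1
        + 1 / 2 * d * r * b ^ 2 * h - 1 / 2 * c * b ^ 2 * (w0 3 - hs 0 3 + t03)
    simpa [hd.ne', h3.ne', hc.ne'] using this

theorem eq_zero_of_alternating {s : Fin 5 → Fin 5 → Fin 5 → ℝ} (h1 : ∀ i j k, s i j k = -s j i k)
    (h2 : ∀ i j k, s i j k = -s i k j) (h : ∀ i j k, i < j → j < k → s i j k = 0)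
    (i j k : Fin 5) : s i j k = 0 := by
  have h3 : ∀ i k, s i i k = 0 := fun i k => by linarith [h1 i i k]
  have h4 : ∀ i k, s k i i = 0 := fun i k => by linarith [h2 k i i]
  have hlt : ∀ i j k, i < j → s i j k = 0 := by
    intro i j k hij
    rcases lt_trichotomy j k with hjk | rfl | hjk
    · exact h i j k hij hjk
    · exact h4 _ _
    · rcases lt_trichotomy i k with hik | rfl | hik
      · rw [h2, h i k j hik hjk, neg_zero]
      · rw [h2, h3, neg_zero]
      · rw [h2, h1, h k i j hik hij, neg_zero, neg_zero]
  rcases lt_trichotomy i j with hij | rfl | hij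
  · exact hlt i j k hij
  · exact h3 _ _
  · rw [h1, hlt j i k hij, neg_zero]

/-- `A` depends on fields, not visibly on their values at `g`. Only the last slot is evidently
pointwise and linear, and the skew symmetries move each argument into it, so testing on a basis
suffices without proving tensoriality. -/
theorem eq_zero_of_alternating_of_basis {α β γ : ℝ} {A : VField → VField → Mm} {g : G}
    (h1 : ∀ X Y Z : VField, metric α β γ (A X Y) (Z g) = -metric α β γ (A Y X) (Z g))
    (h2 : ∀ X Y Z : VField, metric α β γ (A X Y) (Z g) = -metric α β γ (A X Z) (Y g))
    {B : Fin 5 → VField} (hB : ∀ i, B i g = Pi.single i 1)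
    (h : ∀ i j k, metric α β γ (A (B i) (B j)) (B k g) = 0) (X Y Z : VField) :
    metric α β γ (A X Y) (Z g) = 0 := by
  have key : ∀ v : Mm, (∀ i, metric α β γ v (B i g) = 0) → ∀ w, metric α β γ v w = 0 := by
    intro v hv w
    have e0 := hv 0
    have e1 := hv 1
    have e2 := hv 2
    have e3 := hv 3
    have e4 := hv 4
    rw [hB, metric_eq] at e0 e1 e2 e3 e4
    simp only [Pi.single_apply] at e0 e1 e2 e3 e4
    simp [-mul_eq_zero] at e0 e1 e2 e3 e4
    rw [metric_eq]
    linear_combination w 0 * e0 + w 1 * e1 + w 2 * e2 + w 3 * e3 + w 4 * e4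
  refine key _ (fun i => ?_) _
  rw [h2, neg_eq_zero]
  refine key _ (fun j => ?_) _
  rw [h1, h2, neg_neg]
  exact key _ (fun k => h i j k) _

theorem irCharacteristic_unique {α β γ : ℝ} (hα : 0 < α) (hβ : 0 < β) (hγ : 0 < γ)
    {nabla nabla' : VField → VField → VField} (h : IsIrCharacteristic α β γ nabla)
    (h' : IsIrCharacteristic α β γ nabla') : nabla = nabla' := by
  obtain ⟨hm, hs, hU⟩ := h
  obtain ⟨hm', hs', hU'⟩ := h'
  have key : ∀ (X Y Z : VField) (g : G),
      metric α β γ (nabla X Y g - nabla' X Y g) (Z g) = 0 := by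
    intro X Y Z g
    choose B hB using fun i : Fin 5 => exists_vField g (Pi.single i 1)
    set A : VField → VField → Mm := fun X Y => nabla X Y g - nabla' X Y g with hA
    have h1 : ∀ X Y Z : VField, metric α β γ (A X Y) (Z g) = -metric α β γ (A Y X) (Z g) :=
      fun X Y Z => skew_difference hm hm' hs hs' X Y Z g
    have h2 : ∀ X Y Z : VField, metric α β γ (A X Y) (Z g) = -metric α β γ (A X Z) (Y g) :=
      fun X Y Z => metric_difference hm hm' X Y Z g
    have hΥ : ∀ X Y Z W : VField, upsilon α β γ (A X Y) (Z g) (W g)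
        + upsilon α β γ (Y g) (A X Z) (W g) + upsilon α β γ (Y g) (Z g) (A X W) = 0 := by
      intro X Y Z W
      have u := hU X Y Z W g
      rw [← hU' X Y Z W g] at u
      simp only [nablaUpsilon, upsilonF, upsilon_eq] at u
      simp only [hA, upsilon_eq, Pi.sub_apply]
      linear_combination -u
    set s : Fin 5 → Fin 5 → Fin 5 → ℝ := fun i j k =>
      metric α β γ (A (B i) (B j)) (B k g) with hs_def
    have hT : ∀ i j k, s i j k = weight α β γ k * A (B i) (B j) k := by
      intro i j k
      simp only [hs_def, hB, metric]
      rw [Finset.sum_eq_single k (fun l _ hl => by simp [hl]) (by simp)]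
      simp
    have s1 : ∀ i j k, s i j k = -s j i k := fun i j k => h1 _ _ _
    have s2 : ∀ i j k, s i j k = -s i k j := fun i j k => h2 _ _ _
    -- Every contraction `s i` lies in the stabilizer of `Υ`. Its relations, applied to different
    -- slots of the alternating `s`, kill all ten independent components.
    have st := fun i => stabilizer_upsilon hα hβ hγ (hT i) (s2 i) (fun j l m => by
      have := hΥ (B i) (B j) (B l) (B m)
      rwa [hB, hB, hB] at this)
    have d : ∀ i k, s i i k = 0 := fun i k => by linarith [s1 i i k]
    have d' : ∀ i k, s i k i = 0 := fun i k => by rw [s2, d, neg_zero]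
    have s013 : s 0 1 3 = 0 := by rw [s1, (st 1).1, neg_zero]
    have s023 : s 0 2 3 = 0 := by rw [s1, (st 2).1, neg_zero]
    have s014 : s 0 1 4 = 0 := by rw [s1, (st 1).2.1, neg_zero]
    have s024 : s 0 2 4 = 0 := by rw [s1, (st 2).2.1, neg_zero]
    have s034 : s 0 3 4 = 0 := by rw [s1, (st 3).2.1, neg_zero]
    have s123 : s 1 2 3 = 0 := (st 1).2.2.1 (d' 1 0)
    have s012 : s 0 1 2 = 0 := (st 0).2.2.2.2.2 s034
    have s124 : s 1 2 4 = 0 := (st 1).2.2.2.1 (by rw [s1, s012, neg_zero])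
    have s134 : s 1 3 4 = 0 := (st 1).2.2.2.2.1 (d 1 2)
    have s234 : s 2 3 4 = 0 := (st 2).2.2.2.2.1 (d' 2 1)
    refine eq_zero_of_alternating_of_basis h1 h2 hB (eq_zero_of_alternating s1 s2 ?_) X Y Z
    intro i j k hij hjk
    fin_cases i <;> fin_cases j <;> first
      | exact absurd hij (by decide)
      | (fin_cases k <;> first
          | exact absurd hjk (by decide)
          | assumption)
  funext X Y
  refine VField.ext (funext fun g => ?_)
  rw [← sub_eq_zero]
  refine eq_zero_of_metric_self hα hβ hγ ?_
  rw [metric_sub_right, key, key, sub_zero]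

end

end TwistedStiefel

/-! ### Assembly of the theorem -/

open TwistedStiefel in
theorem mainTheorem5 (α β γ : ℝ) (hα : 0 < α) (hβ : 0 < β) (hγ : 0 < γ) :
    -- The invariant almost contact metric structures are `(±e₁, ±e₁, ±φ_+)` and
    -- `(±e₁, ±e₁, ±φ_-)`, with independent signs for `(ξ, η)` and for `φ`.
    (∀ (ξ : VField) (η : OneForm) (φ : EndField),
      IsInvariantACM α β γ ξ η φ ↔
        ∃ ε ∈ ({1, -1} : Set ℝ), ∃ δ ∈ ({1, -1} : Set ℝ), ∃ τ ∈ ({1, -1} : Set ℝ),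
          ∀ g, ξ g = ε • xi α β γ g ∧ η g = ε • eta α β γ g ∧ φ g = δ • phi α β γ τ g) ∧
    -- `φ_+` and `φ_-` are different, also up to sign.
    (∀ g, phi α β γ 1 g ≠ phi α β γ (-1) g ∧ phi α β γ 1 g ≠ -phi α β γ (-1) g) ∧
    (∀ (ξ : VField) (η : OneForm) (φ : EndField), IsInvariantACM α β γ ξ η φ →
      IsNormal ξ η φ ∧
      (∀ X Y Z g, dTwo (fundForm α β γ φ) X Y Z g = 0) ∧
      (∃! nabla, IsContactCharacteristic α β γ ξ η φ nabla) ∧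
      (∀ nabla, IsContactCharacteristic α β γ ξ η φ nabla →
        ∀ X Y Z g,
          torsion3 α β γ nabla X Y Z g = etaWedgeDEta η X Y Z g ∧
          torsion3 α β γ nabla X Y Z g =
            2 * √α / (5 * β) * wedge3 α β γ 0 1 2 (X g) (Y g) (Z g)
              - √α / (5 * γ) * wedge3 α β γ 0 3 4 (X g) (Y g) (Z g)) ∧
      (IsNearlyIntegrable α β γ →
        ∀ nabla, IsContactCharacteristic α β γ ξ η φ nabla ↔ IsIrCharacteristic α β γ nabla)) ∧
    (IsSasakian α β γ (xi α β γ) (eta α β γ) (phi α β γ 1) ↔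
      α = 25 * β ^ 2 ∧ 25 * β ^ 2 = 100 * γ ^ 2) ∧
    (IsSasakian α β γ (xi α β γ) (eta α β γ) (phi α β γ 1) ∧ IsNearlyIntegrable α β γ ↔
      α = 25 / 36 ∧ β = 1 / 6 ∧ γ = 1 / 12) := by
  refine ⟨isInvariantACM_iff hα hβ hγ, phi_one_ne α hβ hγ, fun ξ η φ h => ?_, ?_, ?_⟩
  · obtain ⟨ε, a, b, hS⟩ := h.exists_isStandard hα
    have hc := hS.isContactCharacteristic hβ hγ
    refine ⟨hS.isNormal hα, hS.dTwo_fundForm β γ, ⟨charConn α β γ, hc, fun nabla hn =>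
      hS.contactCharacteristic_unique hα hβ hγ hn hc⟩, fun nabla hn X Y Z g => ?_,
      fun hN nabla => ⟨fun hn => ?_, fun hn => ?_⟩⟩
    · rw [hS.contactCharacteristic_unique hα hβ hγ hn hc, charConn_torsion3 hβ hγ,
        hS.etaWedgeDEta_eq hα, wedge3_eq α β γ hα hβ hγ]
      exact ⟨rfl, rfl⟩
    · rw [hS.contactCharacteristic_unique hα hβ hγ hn hc]
      exact charConn_isIrCharacteristic hα hβ hγ hN
    · rw [irCharacteristic_unique hα hβ hγ hn (charConn_isIrCharacteristic hα hβ hγ hN)]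
      exact hc
  · exact (isStandard_phi hβ hγ).isSasakian_iff hα hβ hγ
  · rw [(isStandard_phi hβ hγ).isSasakian_iff hα hβ hγ, isNearlyIntegrable_iff hα hβ hγ]
    constructor
    · rintro ⟨⟨h1, h2⟩, h3⟩
      -- The Sasakian condition gives `β² = 4γ²`, and positivity selects the root. Then `α = 100γ²`
      -- and `q = 2p` becomes `1 - 20γ = 40γ - 4`.
      have hβγ : β = 2 * γ := by
        have : (β - 2 * γ) * (β + 2 * γ) = 0 := by linear_combination h2 / 25
        rcases mul_eq_zero.1 this with h | h
        · linarith
        · linarith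
      have hγ' : γ = 1 / 12 := by
        rw [h1, hβγ] at h3
        field_simp at h3
        linarith
      have hβ' : β = 1 / 6 := by rw [hβγ, hγ']; norm_num
      refine ⟨?_, hβ', hγ'⟩
      rw [h1, hβ']
      norm_num
    · rintro ⟨rfl, rfl, rfl⟩
      norm_num
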